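/- (i) For every $\epsilon>0$ there exist $n_0\in\mathbb{N}$ and $\delta>0$ such that, for every $n\ge n_0$, every (finite simple) graph on $n$ vertices containing at most $\delta n^2$ copies of the 5-cycle $C_5$ (that is, at most $\delta n^2$ not necessarily induced subgraphs isomorphic to $C_5$) can be made triangle-free by deleting at most $\epsilon n^{3/2}$ edges. In short: an $n$-vertex graph with $o(n^2)$ copies of $C_5$ can be made triangle-free by deleting $o(n^{3/2})$ edges. (ii) In particular, for every $\epsilon>0$ there exists $n_0\in\mathbb{N}$ such that, for every $n\ge n_0$, every $n$-vertex graph containing no copy of $C_5$ as a (not necessarily induced) subgraph can be made triangle-free by deleting at most $\epsilon n^{3/2}$ edges. -/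

import Mathlib

universe u

/-! Take a largest family `T` of edge-disjoint triangles of `G`. Deleting their edges destroys all
triangles, so it suffices to show that a family with at least `ε n^(3/2)` members forces more than
`δ n²` copies of `C₅`. Suppose it does not, and let `H` be the union of the triangles. Replacing an
edge of a 4-cycle of `H` by the other two sides of a triangle of the family gives a 5-cycle of `G`
(`exists_isPentagon`), so `H` has `O(δ n²)` 4-cycles: most pairs have at most one common neighbour.
After a few vertices are dropped (`exists_pruned`), all degrees are `O(√n)`, and the square of the
adjacency matrix `A` is, up to a small `L¹` error in each row, the 0-1 matrix `U` of pairs with a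
common neighbour.

This makes `A` behave like a dense matrix scaled by `n^(-1/2)`. If `P` averages over the classes of
a partition, then `‖PAP‖² ≤ tr (P A²)`, which is `O(n)`; hence weak regularity applies
(`exists_weak_regular_coloring`), and some `B = PAP` with boundedly many classes is within `η
n^(3/2)` of `A` in cut norm. Averaging `T` along with `A` gives a fractional triangle packing in
`B`; with the `L²` bound on `B`, this shows that the graph `B ≥ c / √n` is far from triangle-free
(`farFromTriangleFree_thresholdGraph`). By triangle removal it has many triangles, hence of order
`n⁵` closed 5-walks.

A counting lemma (`count_ge_closedWalkFive`) transfers these to `A`: there are at least `κ n^(5/2)`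
triples `(x, y, z)` with `yz` an edge and `x` a second neighbour of both `y` and `z`. Such a triple
lies on a 5-cycle `x w y z v` of `G` unless vertices coincide, and few triples are degenerate
(`card_wedge_le`). So there are of order `n^(5/2)` copies of `C₅`, a contradiction for large `n`. -/

section
open Finset Matrix

/-! ### Block averages, their energy, and weak regularity -/

section WeakRegularity
variable {V : Type*} [Fintype V]

/-- The matrix averaging a function over the classes of a colouring. -/
noncomputable def cellAvg {k : ℕ} (c : V → Fin k) : Matrix V V ℝ :=
  fun x y => if c x = c y then (#{z | c z = c x} : ℝ)⁻¹ else 0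

lemma cellAvg_nonneg {k : ℕ} (c : V → Fin k) (x y : V) : 0 ≤ cellAvg c x y := by
  unfold cellAvg; split_ifs <;> positivity

lemma cellAvg_comm {k : ℕ} (c : V → Fin k) (x y : V) : cellAvg c x y = cellAvg c y x := by
  unfold cellAvg
  by_cases h : c x = c y
  · simp [h]
  · simp [h, Ne.symm h]

lemma cellAvg_transpose {k : ℕ} (c : V → Fin k) : (cellAvg c)ᵀ = cellAvg c := by
  ext x y; exact cellAvg_comm c y x

lemma card_cell_pos {k : ℕ} (c : V → Fin k) (x : V) : (0 : ℝ) < #{z | c z = c x} := by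
  have : x ∈ ({z | c z = c x} : Finset V) := by simp
  exact_mod_cast card_pos.2 ⟨x, this⟩

lemma cellAvg_mulVec_of_const {k : ℕ} (c : V → Fin k) (v : V → ℝ)
    (hv : ∀ x y, c x = c y → v x = v y) : cellAvg c *ᵥ v = v := by
  ext x
  have h : ∀ y, cellAvg c x y * v y
      = if c y = c x then (#{z | c z = c x} : ℝ)⁻¹ * v x else 0 := by
    intro y
    unfold cellAvg
    by_cases h : c x = c y
    · simp [h, hv x y h]
    · simp [h, Ne.symm h]
  rw [mulVec, dotProduct, sum_congr rfl fun y _ => h y, ← sum_filter, sum_const, nsmul_eq_mul]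
  field_simp [(card_cell_pos c x).ne']

lemma cellAvg_row_sum {k : ℕ} (c : V → Fin k) (x : V) : ∑ y, cellAvg c x y = 1 := by
  have := congrFun (cellAvg_mulVec_of_const c (fun _ => 1) (by simp)) x
  simpa [mulVec, dotProduct] using this

lemma cellAvg_mul_of_refines {k l : ℕ} (c : V → Fin k) (c' : V → Fin l)
    (h : ∀ x y, c' x = c' y → c x = c y) : cellAvg c' * cellAvg c = cellAvg c := by
  ext x y
  have := congrFun (cellAvg_mulVec_of_const c' (fun z => cellAvg c z y) (by
    intro x x' hx
    simp [cellAvg, h _ _ hx])) x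
  simpa [mulVec, dotProduct, mul_apply] using this

lemma mul_cellAvg_of_refines {k l : ℕ} (c : V → Fin k) (c' : V → Fin l)
    (h : ∀ x y, c' x = c' y → c x = c y) : cellAvg c * cellAvg c' = cellAvg c := by
  have := congrArg transpose (cellAvg_mul_of_refines c c' h)
  simpa [transpose_mul, cellAvg_transpose] using this

lemma cellAvg_mul_self {k : ℕ} (c : V → Fin k) : cellAvg c * cellAvg c = cellAvg c :=
  cellAvg_mul_of_refines c c fun _ _ h => h

/-- Each nonempty class contributes exactly 1: the trace is the rank of a projection. It controls
the cost of exceptional codegrees in `blockEnergy_le`. -/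
lemma trace_cellAvg_le {k : ℕ} (c : V → Fin k) : ∑ x, cellAvg c x x ≤ k := by
  calc ∑ x, cellAvg c x x = ∑ i : Fin k, ∑ x with c x = i, cellAvg c x x :=
        (sum_fiberwise _ _ _).symm
    _ ≤ ∑ _i : Fin k, (1 : ℝ) := by
        refine sum_le_sum fun i _ => ?_
        have : ∀ x ∈ ({x | c x = i} : Finset V), cellAvg c x x = (#{z | c z = i} : ℝ)⁻¹ := by
          intro x hx
          simp only [mem_filter, mem_univ, true_and] at hx
          simp [cellAvg, hx]
        rw [sum_congr rfl this, sum_const, nsmul_eq_mul]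
        exact mul_inv_le_one
    _ = k := by simp

lemma cellAvg_le_diag {k : ℕ} (c : V → Fin k) (x y : V) : cellAvg c x y ≤ cellAvg c x x := by
  unfold cellAvg; split_ifs <;> simp_all

/-- A matrix averaged over the blocks of a colouring. -/
noncomputable def blockAvg {k : ℕ} (c : V → Fin k) (A : Matrix V V ℝ) : Matrix V V ℝ :=
  cellAvg c * A * cellAvg c

lemma blockAvg_apply {k : ℕ} (c : V → Fin k) (A : Matrix V V ℝ) (x y : V) :
    blockAvg c A x y = ∑ x', ∑ y', cellAvg c x x' * A x' y' * cellAvg c y y' := by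
  simp only [blockAvg, mul_apply, sum_mul]
  rw [sum_comm]
  simp only [cellAvg_comm c _ y]

lemma blockAvg_transpose {k : ℕ} (c : V → Fin k) {A : Matrix V V ℝ} (hA : Aᵀ = A) :
    (blockAvg c A)ᵀ = blockAvg c A := by
  simp [blockAvg, transpose_mul, cellAvg_transpose, hA, Matrix.mul_assoc]

lemma blockAvg_nonneg {k : ℕ} (c : V → Fin k) {A : Matrix V V ℝ} (hA : ∀ x y, 0 ≤ A x y)
    (x y : V) : 0 ≤ blockAvg c A x y := by
  rw [blockAvg_apply]
  exact sum_nonneg fun x' _ => sum_nonneg fun y' _ =>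
    mul_nonneg (mul_nonneg (cellAvg_nonneg _ _ _) (hA _ _)) (cellAvg_nonneg _ _ _)

lemma blockAvg_row_sum_le {k : ℕ} (c : V → Fin k) {A : Matrix V V ℝ} {d : ℝ}
    (hd : ∀ x, ∑ y, A x y ≤ d) (x : V) : ∑ y, blockAvg c A x y ≤ d := by
  calc ∑ y, blockAvg c A x y
      = ∑ x', cellAvg c x x' * ∑ y', A x' y' * ∑ y, cellAvg c y' y := by
        simp only [blockAvg_apply, mul_sum]
        rw [sum_comm]
        refine sum_congr rfl fun x' _ => ?_
        rw [sum_comm]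
        refine sum_congr rfl fun y' _ => sum_congr rfl fun y _ => ?_
        rw [cellAvg_comm c y y']; ring
    _ ≤ ∑ x', cellAvg c x x' * d := by
        refine sum_le_sum fun x' _ => mul_le_mul_of_nonneg_left ?_ (cellAvg_nonneg _ _ _)
        simpa [cellAvg_row_sum] using hd x'
    _ = d := by rw [← sum_mul, cellAvg_row_sum, one_mul]

lemma sum_sq_eq_trace (M : Matrix V V ℝ) : ∑ x, ∑ y, M x y ^ 2 = trace (M * Mᵀ) := by
  simp [trace, mul_apply, sq]

/-- The energy of a matrix with respect to a colouring. -/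
noncomputable def blockEnergy {k : ℕ} (c : V → Fin k) (A : Matrix V V ℝ) : ℝ :=
  ∑ x, ∑ y, blockAvg c A x y ^ 2

lemma blockEnergy_eq_trace {k : ℕ} (c : V → Fin k) {A : Matrix V V ℝ} (hA : Aᵀ = A) :
    blockEnergy c A = trace (cellAvg c * A * cellAvg c * A) := by
  rw [blockEnergy, sum_sq_eq_trace, blockAvg_transpose c hA, blockAvg]
  calc _ = trace (cellAvg c * A * (cellAvg c * cellAvg c) * A * cellAvg c) := by
        simp only [Matrix.mul_assoc]
    _ = trace (cellAvg c * (cellAvg c * A * cellAvg c * A)) := by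
        rw [cellAvg_mul_self, trace_mul_comm]
    _ = _ := by rw [← Matrix.mul_assoc, ← Matrix.mul_assoc, ← Matrix.mul_assoc, cellAvg_mul_self]

/-- With `P = cellAvg c`, this is `‖PAP‖² ≤ ‖PA‖² = tr (P A²)`, from `‖PA - PAP‖² ≥ 0`. The energy
is thereby controlled by codegrees, which is what makes regularity work for a sparse matrix. -/
lemma blockEnergy_le_trace {k : ℕ} (c : V → Fin k) {A : Matrix V V ℝ} (hA : Aᵀ = A) :
    blockEnergy c A ≤ trace (cellAvg c * (A * A)) := by
  have h0 : 0 ≤ ∑ x, ∑ y, (cellAvg c * A - cellAvg c * A * cellAvg c) x y ^ 2 :=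
    sum_nonneg fun x _ => sum_nonneg fun y _ => sq_nonneg _
  rw [sum_sq_eq_trace] at h0
  have hT : (cellAvg c * A - cellAvg c * A * cellAvg c)ᵀ
      = A * cellAvg c - cellAvg c * (A * cellAvg c) := by
    simp [transpose_sub, transpose_mul, cellAvg_transpose, hA]
  rw [hT, Matrix.sub_mul, Matrix.mul_sub, Matrix.mul_sub] at h0
  have e1 : trace (cellAvg c * A * (A * cellAvg c)) = trace (cellAvg c * (A * A)) := by
    rw [← Matrix.mul_assoc, trace_mul_comm, ← Matrix.mul_assoc, ← Matrix.mul_assoc,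
      cellAvg_mul_self, Matrix.mul_assoc]
  have e2 : trace (cellAvg c * A * (cellAvg c * (A * cellAvg c))) = blockEnergy c A := by
    rw [blockEnergy_eq_trace c hA]
    calc _ = trace ((cellAvg c * A * cellAvg c * A) * cellAvg c) := by
          simp only [Matrix.mul_assoc]
      _ = _ := by rw [trace_mul_comm, ← Matrix.mul_assoc, ← Matrix.mul_assoc, ← Matrix.mul_assoc,
            cellAvg_mul_self]
  have e3 : cellAvg c * A * cellAvg c * (A * cellAvg c)
      = cellAvg c * A * (cellAvg c * (A * cellAvg c)) := by simp only [Matrix.mul_assoc]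
  have e4 : cellAvg c * A * cellAvg c * (cellAvg c * (A * cellAvg c))
      = cellAvg c * A * (cellAvg c * (A * cellAvg c)) := by
    rw [Matrix.mul_assoc (cellAvg c * A), ← Matrix.mul_assoc (cellAvg c) (cellAvg c),
      cellAvg_mul_self]
  rw [e3, e4, sub_self, sub_zero, trace_sub, e1, e2] at h0
  linarith

/-- Pythagoras: the coarse average is an orthogonal projection of the fine one, so their inner
product is the coarse energy. -/
lemma blockEnergy_sub_of_refines {k l : ℕ} (c : V → Fin k) (c' : V → Fin l)
    (h : ∀ x y, c' x = c' y → c x = c y) {A : Matrix V V ℝ} (hA : Aᵀ = A) :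
    ∑ x, ∑ y, (blockAvg c' A x y - blockAvg c A x y) ^ 2 = blockEnergy c' A - blockEnergy c A := by
  have e : trace (blockAvg c' A * blockAvg c A) = blockEnergy c A := by
    rw [blockEnergy_eq_trace c hA, blockAvg, blockAvg]
    calc _ = trace (cellAvg c' * (A * (cellAvg c' * cellAvg c) * A * cellAvg c)) := by
          simp only [Matrix.mul_assoc]
      _ = trace (A * cellAvg c * A * (cellAvg c * cellAvg c')) := by
          rw [cellAvg_mul_of_refines c c' h, trace_mul_comm]
          simp only [Matrix.mul_assoc]
      _ = trace (cellAvg c * (A * cellAvg c * A)) := by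
          rw [mul_cellAvg_of_refines c c' h, trace_mul_comm]
      _ = _ := by simp only [Matrix.mul_assoc]
  have e' := e
  rw [trace_mul_comm] at e'
  have := sum_sq_eq_trace (blockAvg c' A - blockAvg c A)
  simp only [Matrix.sub_apply] at this
  rw [this, transpose_sub, blockAvg_transpose c hA, blockAvg_transpose c' hA, Matrix.sub_mul,
    Matrix.mul_sub, Matrix.mul_sub, trace_sub, trace_sub, trace_sub, e, e']
  have h1 : trace (blockAvg c' A * blockAvg c' A) = blockEnergy c' A := by
    rw [blockEnergy, sum_sq_eq_trace, blockAvg_transpose c' hA]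
  have h2 : trace (blockAvg c A * blockAvg c A) = blockEnergy c A := by
    rw [blockEnergy, sum_sq_eq_trace, blockAvg_transpose c hA]
  rw [h1, h2]; ring

lemma sum_blockAvg_of_const {k : ℕ} (c : V → Fin k) (A : Matrix V V ℝ) (a b : V → ℝ)
    (ha : ∀ x y, c x = c y → a x = a y) (hb : ∀ x y, c x = c y → b x = b y) :
    ∑ x, ∑ y, a x * blockAvg c A x y * b y = ∑ x, ∑ y, a x * A x y * b y := by
  have key : ∀ M : Matrix V V ℝ, ∑ x, ∑ y, a x * M x y * b y = a ⬝ᵥ (M *ᵥ b) := by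
    intro M
    simp [dotProduct, mulVec, mul_sum, mul_assoc]
  rw [key, key, blockAvg, ← mulVec_mulVec, cellAvg_mulVec_of_const c b hb, ← mulVec_mulVec,
    dotProduct_mulVec, ← mulVec_transpose, cellAvg_transpose, cellAvg_mulVec_of_const c a ha]

open Classical in
/-- Weak (Frieze–Kannan) regularity for a symmetric matrix of bounded block energy. -/
theorem exists_weak_regular_coloring {A : Matrix V V ℝ} (hA : Aᵀ = A) {m : ℕ} {E t : ℝ}
    (hm : E < m * t)
    (hE : ∀ k ≤ 4 ^ m, ∀ c : V → Fin k, blockEnergy c A ≤ E) :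
    ∃ k ≤ 4 ^ m, ∃ c : V → Fin k, ∀ S T : Finset V,
      (∑ x ∈ S, ∑ y ∈ T, (A x y - blockAvg c A x y)) ^ 2 ≤ t * (Fintype.card V : ℝ) ^ 2 := by
  by_contra! hcon
  have step : ∀ j ≤ m, ∃ k ≤ 4 ^ j, ∃ c : V → Fin k, j * t ≤ blockEnergy c A := by
    intro j
    induction j with
    | zero =>
      intro _
      refine ⟨1, le_rfl, fun _ => 0, ?_⟩
      simp only [Nat.cast_zero, zero_mul]
      exact sum_nonneg fun x _ => sum_nonneg fun y _ => sq_nonneg _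
    | succ j ih =>
      intro hj
      obtain ⟨k, hk, c, hc⟩ := ih (by omega)
      -- Split every class by membership in the violating sets `S` and `T`. Their indicators are
      -- then constant on the new classes, so `A` may be replaced by its new average in the
      -- discrepancy, and Cauchy–Schwarz gives an energy increment greater than `t`.
      obtain ⟨S, T, hST⟩ := hcon k (hk.trans (Nat.pow_le_pow_right (by norm_num) (by omega))) c
      have hcard : Fintype.card (Fin k × Bool × Bool) = k * 4 := by simp
      let e := Fintype.equivFinOfCardEq hcard
      let c' : V → Fin (k * 4) := fun x => e (c x, decide (x ∈ S), decide (x ∈ T))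
      have hc' : ∀ x y, c' x = c' y → c x = c y ∧ (x ∈ S ↔ y ∈ S) ∧ (x ∈ T ↔ y ∈ T) := by
        intro x y hxy
        simpa [c', e.injective.eq_iff] using hxy
      refine ⟨k * 4, by rw [pow_succ]; gcongr, c', ?_⟩
      have hsub := blockEnergy_sub_of_refines c c' (fun x y h => (hc' x y h).1) hA
      let a : V → ℝ := fun x => if x ∈ S then 1 else 0
      let b : V → ℝ := fun x => if x ∈ T then 1 else 0
      have hab := sum_blockAvg_of_const c' A a b
        (fun x y h => by simp [a, (hc' x y h).2.1]) (fun x y h => by simp [b, (hc' x y h).2.2])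
      have hsum : ∑ x ∈ S, ∑ y ∈ T, (A x y - blockAvg c A x y)
          = ∑ p : V × V, (a p.1 * b p.2) * (blockAvg c' A p.1 p.2 - blockAvg c A p.1 p.2) := by
        have h1 : ∑ x ∈ S, ∑ y ∈ T, (A x y - blockAvg c A x y)
            = ∑ x, ∑ y, a x * (A x y - blockAvg c A x y) * b y := by
          simp [a, b, sum_ite_mem]
        rw [h1, Fintype.sum_prod_type]
        simp only [mul_sub, sub_mul, sum_sub_distrib] at hab ⊢
        rw [← hab]
        congr 1 <;> exact sum_congr rfl fun x _ => sum_congr rfl fun y _ => by ring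
      have hCS := sum_mul_sq_le_sq_mul_sq (univ : Finset (V × V)) (fun p => a p.1 * b p.2)
        (fun p => blockAvg c' A p.1 p.2 - blockAvg c A p.1 p.2)
      rw [← hsum] at hCS
      have h2 : ∑ p : V × V, (a p.1 * b p.2) ^ 2 ≤ (Fintype.card V : ℝ) ^ 2 := by
        calc _ ≤ ∑ _p : V × V, (1 : ℝ) := by
              refine sum_le_sum fun p _ => ?_
              simp only [a, b]; split_ifs <;> simp
          _ = _ := by simp [sq]
      have h3 : ∑ p : V × V, (blockAvg c' A p.1 p.2 - blockAvg c A p.1 p.2) ^ 2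
          = blockEnergy c' A - blockEnergy c A := by
        rw [← hsub, Fintype.sum_prod_type]
      rw [h3] at hCS
      have h4 : 0 ≤ blockEnergy c' A - blockEnergy c A := by
        rw [← hsub]; exact sum_nonneg fun x _ => sum_nonneg fun y _ => sq_nonneg _
      have h5 : t * (Fintype.card V : ℝ) ^ 2
          < (Fintype.card V : ℝ) ^ 2 * (blockEnergy c' A - blockEnergy c A) :=
        hST.trans_le (hCS.trans (mul_le_mul_of_nonneg_right h2 h4))
      have h6 : t < blockEnergy c' A - blockEnergy c A := by
        by_contra hle
        push Not at hle
        have := mul_le_mul_of_nonneg_left hle (sq_nonneg (Fintype.card V : ℝ))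
        linarith
      push_cast
      linarith
  obtain ⟨k, hk, c, hc⟩ := step m le_rfl
  linarith [hE k hk c]

/-- Rows of `cellAvg c` sum to 1, so the part of `A²` bounded by 1 contributes at most `card V`. An
entry of `cellAvg c` is at most the diagonal entry of its row, and the trace is at most `k`, so the
excess `e` costs at most `k * s`. -/
lemma blockEnergy_le {k : ℕ} (c : V → Fin k) {A e : Matrix V V ℝ} (hA : Aᵀ = A)
    (he : ∀ x y, 0 ≤ e x y) (hAe : ∀ x y, (A * A) x y ≤ 1 + e x y) {s : ℝ}
    (hs : ∀ x, ∑ y, e x y ≤ s) (hs0 : 0 ≤ s) : blockEnergy c A ≤ Fintype.card V + k * s := by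
  calc blockEnergy c A ≤ trace (cellAvg c * (A * A)) := blockEnergy_le_trace c hA
    _ = ∑ x, ∑ y, cellAvg c x y * (A * A) x y := by
        have hT : (A * A)ᵀ = A * A := by rw [transpose_mul, hA]
        simp only [trace, diag_apply, mul_apply (M := cellAvg c)]
        refine sum_congr rfl fun x _ => sum_congr rfl fun y _ => ?_
        conv_lhs => rw [← hT, transpose_apply]
    _ ≤ ∑ x, ∑ y, (cellAvg c x y + cellAvg c x x * e x y) := by
        refine sum_le_sum fun x _ => sum_le_sum fun y _ => ?_
        have h1 := mul_le_mul_of_nonneg_left (hAe x y) (cellAvg_nonneg c x y)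
        have h2 := mul_le_mul_of_nonneg_right (cellAvg_le_diag c x y) (he x y)
        linarith
    _ ≤ ∑ x, (1 + cellAvg c x x * s) := by
        refine sum_le_sum fun x _ => ?_
        rw [sum_add_distrib, cellAvg_row_sum, ← mul_sum]
        gcongr
        · exact cellAvg_nonneg _ _ _
        · exact hs x
    _ ≤ _ := by
        rw [sum_add_distrib, ← sum_mul]
        have := trace_cellAvg_le c
        have := mul_le_mul_of_nonneg_right this hs0
        simpa using this

end WeakRegularity

/-! ### Cut norm and the counting lemma for 5-cycles -/

section Counting
variable {V : Type*} [Fintype V]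

lemma sum_mul_le_sum_filter_pos {a g : V → ℝ} (ha0 : ∀ x, 0 ≤ a x) (ha1 : ∀ x, a x ≤ 1) :
    ∑ x, a x * g x ≤ ∑ x with 0 < g x, g x := by
  rw [sum_filter]
  refine sum_le_sum fun x _ => ?_
  split_ifs with h
  · nlinarith [ha1 x]
  · exact mul_nonpos_of_nonneg_of_nonpos (ha0 x) (not_lt.1 h)

/-- The form is linear in each of `a` and `b` separately, so each can be replaced by the indicator
of the set where its coefficient is positive. -/
lemma bilin_le_of_cut_le {M : Matrix V V ℝ} {τ : ℝ}
    (h : ∀ S T : Finset V, ∑ x ∈ S, ∑ y ∈ T, M x y ≤ τ) {a b : V → ℝ}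
    (ha0 : ∀ x, 0 ≤ a x) (ha1 : ∀ x, a x ≤ 1) (hb0 : ∀ x, 0 ≤ b x) (hb1 : ∀ x, b x ≤ 1) :
    ∑ x, ∑ y, a x * M x y * b y ≤ τ := by
  calc ∑ x, ∑ y, a x * M x y * b y = ∑ x, a x * ∑ y, M x y * b y := by
        simp only [mul_sum, mul_assoc]
    _ ≤ ∑ x with 0 < ∑ y, M x y * b y, ∑ y, M x y * b y := sum_mul_le_sum_filter_pos ha0 ha1
    _ = ∑ y, b y * ∑ x with 0 < ∑ y, M x y * b y, M x y := by
        rw [sum_comm]; simp only [mul_sum, mul_comm]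
    _ ≤ _ := sum_mul_le_sum_filter_pos hb0 hb1
    _ ≤ τ := by rw [sum_comm]; exact h _ _

lemma abs_bilin_le_of_cut_le {M : Matrix V V ℝ} {τ : ℝ}
    (h : ∀ S T : Finset V, |∑ x ∈ S, ∑ y ∈ T, M x y| ≤ τ) {a b : V → ℝ}
    (ha0 : ∀ x, 0 ≤ a x) (ha1 : ∀ x, a x ≤ 1) (hb0 : ∀ x, 0 ≤ b x) (hb1 : ∀ x, b x ≤ 1) :
    |∑ x, ∑ y, a x * M x y * b y| ≤ τ := by
  refine abs_le'.2 ⟨bilin_le_of_cut_le (fun S T => (abs_le'.1 (h S T)).1) ha0 ha1 hb0 hb1, ?_⟩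
  have := bilin_le_of_cut_le (M := -M) (τ := τ)
    (fun S T => by simpa using (abs_le'.1 (h S T)).2) ha0 ha1 hb0 hb1
  simpa using this

lemma bilin_eq_dotProduct (M : Matrix V V ℝ) (a b : V → ℝ) :
    ∑ x, ∑ y, a x * M x y * b y = a ⬝ᵥ (M *ᵥ b) := by
  simp [dotProduct, mulVec, mul_sum, mul_assoc]

lemma mulVec_nonneg_of_nonneg {M : Matrix V V ℝ} (hM : ∀ x y, 0 ≤ M x y) {b : V → ℝ}
    (hb : ∀ x, 0 ≤ b x) (x : V) : 0 ≤ (M *ᵥ b) x :=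
  sum_nonneg fun y _ => mul_nonneg (hM x y) (hb y)

lemma mulVec_le_of_row_sum_le {M : Matrix V V ℝ} (hM : ∀ x y, 0 ≤ M x y) {d : ℝ}
    (hd : ∀ x, ∑ y, M x y ≤ d) {b : V → ℝ} (hb : ∀ x, b x ≤ 1) (x : V) : (M *ᵥ b) x ≤ d :=
  (sum_le_sum fun y _ => mul_le_of_le_one_right (hM x y) (hb y)).trans (hd x)

/-- If `A` and `B` are close in cut norm and have bounded row sums, so are their squares. -/
lemma bilin_sq_sub_le {A B : Matrix V V ℝ} (hA : Aᵀ = A) (hB : Bᵀ = B)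
    (hA0 : ∀ x y, 0 ≤ A x y) (hB0 : ∀ x y, 0 ≤ B x y) {d τ : ℝ} (hd : 0 < d)
    (hAd : ∀ x, ∑ y, A x y ≤ d) (hBd : ∀ x, ∑ y, B x y ≤ d)
    (h : ∀ S T : Finset V, |∑ x ∈ S, ∑ y ∈ T, (A x y - B x y)| ≤ τ) {a b : V → ℝ}
    (ha0 : ∀ x, 0 ≤ a x) (ha1 : ∀ x, a x ≤ 1) (hb0 : ∀ x, 0 ≤ b x) (hb1 : ∀ x, b x ≤ 1) :
    ∑ x, ∑ y, a x * (B * B) x y * b y - 2 * d * τ ≤ ∑ x, ∑ y, a x * (A * A) x y * b y := by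
  -- Write `A² - B² = A (A - B) + (A - B) B`, and move the outer factor onto the test vector; its
  -- entries then lie in `[0, d]`, whence one factor `d` for each term.
  have scale : ∀ u v : V → ℝ, (∀ x, 0 ≤ u x) → (∀ x, u x ≤ d) → (∀ x, 0 ≤ v x) →
      (∀ x, v x ≤ 1) → |u ⬝ᵥ ((A - B) *ᵥ v)| ≤ d * τ := by
    intro u v hu0 hu1 hv0 hv1
    have := abs_bilin_le_of_cut_le (M := A - B) h (a := fun x => d⁻¹ * u x) (b := v)
      (fun x => mul_nonneg (inv_nonneg.2 hd.le) (hu0 x))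
      (fun x => by rw [inv_mul_le_iff₀ hd]; simpa using hu1 x) hv0 hv1
    rw [bilin_eq_dotProduct] at this
    change |(d⁻¹ • u) ⬝ᵥ _| ≤ τ at this
    rwa [smul_dotProduct, smul_eq_mul, abs_mul, abs_of_pos (inv_pos.2 hd),
      inv_mul_le_iff₀ hd] at this
  rw [bilin_eq_dotProduct, bilin_eq_dotProduct]
  have h1 := scale (A *ᵥ a) b (mulVec_nonneg_of_nonneg hA0 ha0)
    (mulVec_le_of_row_sum_le hA0 hAd ha1) hb0 hb1
  have h2 := scale (B *ᵥ b) a (mulVec_nonneg_of_nonneg hB0 hb0)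
    (mulVec_le_of_row_sum_le hB0 hBd hb1) ha0 ha1
  have e1 : (A *ᵥ a) ⬝ᵥ ((A - B) *ᵥ b) = a ⬝ᵥ ((A * A) *ᵥ b) - a ⬝ᵥ ((A * B) *ᵥ b) := by
    rw [← mulVec_mulVec, ← mulVec_mulVec, ← dotProduct_sub, ← mulVec_sub, ← sub_mulVec,
      dotProduct_mulVec a, ← mulVec_transpose, hA]
  have e2 : (B *ᵥ b) ⬝ᵥ ((A - B) *ᵥ a) = a ⬝ᵥ ((A * B) *ᵥ b) - a ⬝ᵥ ((B * B) *ᵥ b) := by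
    rw [← mulVec_mulVec, ← mulVec_mulVec, ← dotProduct_sub, ← sub_mulVec,
      dotProduct_mulVec a, ← mulVec_transpose, transpose_sub, hA, hB, dotProduct_comm]
  rw [e1] at h1
  rw [e2] at h2
  linarith [(abs_le.1 h1).1, (abs_le.1 h2).1]

/-- The number of closed walks of length five, for a weighted graph. -/
noncomputable def closedWalkFive (D : Matrix V V ℝ) : ℝ :=
  ∑ y, ∑ w, D w y * ∑ x, ∑ z, D x w * (D * D) x z * D y z

theorem count_ge_closedWalkFive {A B U D : Matrix V V ℝ} (hA : Aᵀ = A) (hB : Bᵀ = B)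
    (hA0 : ∀ x y, 0 ≤ A x y) (hB0 : ∀ x y, 0 ≤ B x y) {d τ ω β : ℝ} (hd : 0 < d) (hτ : 0 ≤ τ)
    (hω : 0 ≤ ω) (hβ : 0 ≤ β)
    (hAd : ∀ x, ∑ y, A x y ≤ d) (hBd : ∀ x, ∑ y, B x y ≤ d)
    (h : ∀ S T : Finset V, |∑ x ∈ S, ∑ y ∈ T, (A x y - B x y)| ≤ τ)
    (hU0 : ∀ x y, 0 ≤ U x y) (hU1 : ∀ x y, U x y ≤ 1) (hUA : ∀ x y, U x y ≤ (A * A) x y)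
    (hAU : ∑ x, ∑ y, ((A * A) x y - U x y) ≤ ω)
    (hD0 : ∀ x y, 0 ≤ D x y) (hD1 : ∀ x y, D x y ≤ 1) (hDB : ∀ x y, β * D x y ≤ B x y) :
    β ^ 5 * closedWalkFive D - β ^ 3 * (Fintype.card V : ℝ) ^ 2 * (2 * d * τ + ω)
        - β * Fintype.card V * (2 * d * τ + ω) - Fintype.card V * τ
      ≤ ∑ x, ∑ y, ∑ z, U x y * A y z * U x z := by
  set n : ℝ := (Fintype.card V : ℝ)
  set ρ := 2 * d * τ + ω
  have hρ : 0 ≤ ρ := by positivity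
  have hDD : ∀ x y, β ^ 2 * (D * D) x y ≤ (B * B) x y := by
    intro x y
    rw [mul_apply, mul_apply, mul_sum]
    refine sum_le_sum fun w _ => ?_
    calc β ^ 2 * (D x w * D w y) = (β * D x w) * (β * D w y) := by ring
      _ ≤ _ := mul_le_mul (hDB _ _) (hDB _ _) (mul_nonneg hβ (hD0 _ _)) (hB0 _ _)
  have key : ∀ a b : V → ℝ, (∀ x, 0 ≤ a x) → (∀ x, a x ≤ 1) → (∀ x, 0 ≤ b x) →
      (∀ x, b x ≤ 1) →
      β ^ 2 * ∑ x, ∑ y, a x * (D * D) x y * b y - ρ ≤ ∑ x, ∑ y, a x * U x y * b y := by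
    intro a b ha0 ha1 hb0 hb1
    have h1 := bilin_sq_sub_le hA hB hA0 hB0 hd hAd hBd h ha0 ha1 hb0 hb1
    have h2 : β ^ 2 * ∑ x, ∑ y, a x * (D * D) x y * b y
        ≤ ∑ x, ∑ y, a x * (B * B) x y * b y := by
      simp only [mul_sum]
      refine sum_le_sum fun x _ => sum_le_sum fun y _ => ?_
      calc _ = a x * (β ^ 2 * (D * D) x y) * b y := by ring
        _ ≤ _ := mul_le_mul_of_nonneg_right (mul_le_mul_of_nonneg_left (hDD x y) (ha0 x)) (hb0 y)
    have h3 : ∑ x, ∑ y, a x * (A * A) x y * b y - ∑ x, ∑ y, a x * U x y * b y ≤ ω := by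
      refine le_trans ?_ hAU
      rw [← sum_sub_distrib]
      refine sum_le_sum fun x _ => ?_
      rw [← sum_sub_distrib]
      refine sum_le_sum fun y _ => ?_
      calc _ = (a x * b y) * ((A * A) x y - U x y) := by ring
        _ ≤ _ := mul_le_of_le_one_left (by linarith [hUA x y])
          (mul_le_one₀ (ha1 x) (hb0 y) (hb1 y))
    simp only [ρ]; linarith
  -- The three factors are replaced one at a time: `A y z` for fixed `x`, then `U x y` for fixed
  -- `z`, then `U x z` for fixed `y` and `w`. The remaining factors serve as test functions and must
  -- lie in `[0, 1]`, which is why `U` is used in place of `A²`.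
  have sX : β * ∑ z, ∑ x, ∑ y, U x z * U x y * D y z - n * τ
      ≤ ∑ x, ∑ y, ∑ z, U x y * A y z * U x z := by
    have : ∀ x, β * ∑ y, ∑ z, U x z * U x y * D y z - τ ≤ ∑ y, ∑ z, U x y * A y z * U x z := by
      intro x
      have h1 := abs_bilin_le_of_cut_le (M := A - B) h (hU0 x) (hU1 x) (hU0 x) (hU1 x)
      simp only [Matrix.sub_apply, mul_sub, sub_mul, sum_sub_distrib] at h1
      have h2 : β * ∑ y, ∑ z, U x z * U x y * D y z ≤ ∑ y, ∑ z, U x y * B y z * U x z := by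
        simp only [mul_sum]
        refine sum_le_sum fun y _ => sum_le_sum fun z _ => ?_
        calc _ = U x y * (β * D y z) * U x z := by ring
          _ ≤ _ := mul_le_mul_of_nonneg_right
            (mul_le_mul_of_nonneg_left (hDB y z) (hU0 x y)) (hU0 x z)
      linarith [(abs_le.1 h1).1]
    have h4 := sum_le_sum fun x (_ : x ∈ (univ : Finset V)) => this x
    rw [sum_sub_distrib, ← mul_sum, sum_const, card_univ, nsmul_eq_mul] at h4
    have h5 : ∑ z, ∑ x, ∑ y, U x z * U x y * D y z = ∑ x, ∑ y, ∑ z, U x z * U x y * D y z := by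
      rw [sum_comm]; exact sum_congr rfl fun x _ => sum_comm
    rw [h5]; exact h4
  have sY : β ^ 2 * ∑ y, ∑ w, D w y * ∑ x, ∑ z, D x w * U x z * D y z - n * ρ
      ≤ ∑ z, ∑ x, ∑ y, U x z * U x y * D y z := by
    have h4 := sum_le_sum fun z (_ : z ∈ (univ : Finset V)) =>
      key (fun x => U x z) (fun y => D y z) (fun x => hU0 x z) (fun x => hU1 x z)
        (fun y => hD0 y z) (fun y => hD1 y z)
    rw [sum_sub_distrib, ← mul_sum, sum_const, card_univ, nsmul_eq_mul] at h4
    refine le_trans (le_of_eq ?_) h4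
    congr 2
    simp only [mul_apply, mul_sum, sum_mul]
    have e1 : ∀ F : V → V → V → V → ℝ, ∑ y, ∑ w, ∑ x, ∑ z, F y w x z
        = ∑ z, ∑ x, ∑ y, ∑ w, F y w x z := by
      intro F
      calc _ = ∑ y, ∑ x, ∑ w, ∑ z, F y w x z := sum_congr rfl fun y _ => sum_comm
        _ = ∑ y, ∑ x, ∑ z, ∑ w, F y w x z :=
          sum_congr rfl fun y _ => sum_congr rfl fun x _ => sum_comm
        _ = ∑ x, ∑ y, ∑ z, ∑ w, F y w x z := sum_comm
        _ = ∑ x, ∑ z, ∑ y, ∑ w, F y w x z := sum_congr rfl fun x _ => sum_comm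
        _ = _ := sum_comm
    rw [e1]
    refine sum_congr rfl fun z _ => sum_congr rfl fun x _ => sum_congr rfl fun y _ =>
      sum_congr rfl fun w _ => by ring
  have sZ : β ^ 2 * closedWalkFive D - n ^ 2 * ρ
      ≤ ∑ y, ∑ w, D w y * ∑ x, ∑ z, D x w * U x z * D y z := by
    have h4 := sum_le_sum fun y (_ : y ∈ (univ : Finset V)) =>
      sum_le_sum fun w (_ : w ∈ (univ : Finset V)) =>
        mul_le_mul_of_nonneg_left
          (key (fun x => D x w) (fun z => D y z) (fun x => hD0 x w) (fun x => hD1 x w)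
            (fun z => hD0 y z) (fun z => hD1 y z)) (hD0 w y)
    refine le_trans ?_ h4
    simp only [mul_sub, sum_sub_distrib]
    have e2 : ∑ y, ∑ w, D w y * ρ ≤ n ^ 2 * ρ := by
      calc _ ≤ ∑ _y : V, ∑ _w : V, ρ := sum_le_sum fun y _ => sum_le_sum fun w _ =>
            mul_le_of_le_one_left hρ (hD1 w y)
        _ = _ := by simp [n]; ring
    have e3 : β ^ 2 * closedWalkFive D
        = ∑ y, ∑ w, D w y * (β ^ 2 * ∑ x, ∑ z, D x w * (D * D) x z * D y z) := by
      rw [closedWalkFive, mul_sum]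
      refine sum_congr rfl fun y _ => ?_
      rw [mul_sum]
      exact sum_congr rfl fun w _ => by ring
    rw [e3]; linarith
  have t1 := mul_le_mul_of_nonneg_left sY hβ
  have t2 := mul_le_mul_of_nonneg_left sZ (pow_nonneg hβ 3)
  have e4 : β * (β ^ 2 * ∑ y, ∑ w, D w y * ∑ x, ∑ z, D x w * U x z * D y z - n * ρ)
      = β ^ 3 * ∑ y, ∑ w, D w y * ∑ x, ∑ z, D x w * U x z * D y z - β * n * ρ := by ring
  have e5 : β ^ 3 * (β ^ 2 * closedWalkFive D - n ^ 2 * ρ)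
      = β ^ 5 * closedWalkFive D - β ^ 3 * n ^ 2 * ρ := by ring
  rw [e4] at t1
  rw [e5] at t2
  linarith

end Counting

/-! ### Triangles in dense graphs and averaged triangle packings -/

section DenseTriangles
variable {V : Type*} [Fintype V]

/-- The 4-cycle case of Sidorenko's inequality: Cauchy–Schwarz over the middle vertex, then over
pairs of endpoints. -/
lemma sum_pow_four_le (M : Matrix V V ℝ) (hM : Mᵀ = M) :
    (∑ x, ∑ y, M x y) ^ 4 ≤ (Fintype.card V : ℝ) ^ 4 *
      ∑ y, ∑ w, ∑ x, ∑ v, M y w * M w x * M x v * M v y := by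
  have hs : ∀ x y, M x y = M y x := fun x y => congrFun (congrFun hM.symm x) y
  have h1 : (∑ x, ∑ y, M x y) ^ 2 ≤ (Fintype.card V : ℝ) * ∑ x, (∑ y, M x y) ^ 2 := by
    simpa using sq_sum_le_card_mul_sum_sq (s := (univ : Finset V)) (f := fun x => ∑ y, M x y)
  have h2 : ∑ x, (∑ y, M x y) ^ 2 = ∑ p : V × V, ∑ w, M p.1 w * M w p.2 := by
    rw [Fintype.sum_prod_type]
    simp only [sq, sum_mul_sum]
    calc _ = ∑ w, ∑ y, ∑ x, M y w * M w x :=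
          sum_congr rfl fun w _ => sum_congr rfl fun y _ => sum_congr rfl fun x _ => by
            rw [hs w y]
      _ = ∑ y, ∑ w, ∑ x, M y w * M w x := sum_comm
      _ = _ := sum_congr rfl fun y _ => sum_comm
  have h3 : (∑ p : V × V, ∑ w, M p.1 w * M w p.2) ^ 2
      ≤ (Fintype.card V : ℝ) ^ 2 * ∑ p : V × V, (∑ w, M p.1 w * M w p.2) ^ 2 := by
    simpa [sq] using sq_sum_le_card_mul_sum_sq (s := (univ : Finset (V × V)))
      (f := fun p : V × V => ∑ w, M p.1 w * M w p.2)
  have h4 : ∑ p : V × V, (∑ w, M p.1 w * M w p.2) ^ 2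
      = ∑ y, ∑ w, ∑ x, ∑ v, M y w * M w x * M x v * M v y := by
    rw [Fintype.sum_prod_type]
    refine sum_congr rfl fun y _ => ?_
    rw [sum_comm]
    refine sum_congr rfl fun x _ => ?_
    rw [sq, sum_mul_sum]
    refine sum_congr rfl fun w _ => sum_congr rfl fun v _ => ?_
    rw [hs y v, hs v x]; ring
  rw [h4, ← h2] at h3
  calc (∑ x, ∑ y, M x y) ^ 4 = ((∑ x, ∑ y, M x y) ^ 2) ^ 2 := by ring
    _ ≤ ((Fintype.card V : ℝ) * ∑ x, (∑ y, M x y) ^ 2) ^ 2 :=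
        pow_le_pow_left₀ (sq_nonneg _) h1 2
    _ = (Fintype.card V : ℝ) ^ 2 * (∑ x, (∑ y, M x y) ^ 2) ^ 2 := by ring
    _ ≤ (Fintype.card V : ℝ) ^ 2 * ((Fintype.card V : ℝ) ^ 2 *
        ∑ y, ∑ w, ∑ x, ∑ v, M y w * M w x * M x v * M v y) := by gcongr
    _ = _ := by ring

/-- After a power mean over `z`, apply the 4-cycle bound to the weighted link of `z`. A 4-cycle `y w
x v` in the link contains the path `y w x v`, which closes up through `z` into a 5-walk; the other
factors are at most 1 and are dropped. -/
lemma triangle_pow_four_le_closedWalkFive {D : Matrix V V ℝ} (hD : Dᵀ = D)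
    (hD0 : ∀ x y, 0 ≤ D x y) (hD1 : ∀ x y, D x y ≤ 1) :
    (∑ z, ∑ x, ∑ y, D z x * D z y * D x y) ^ 4
      ≤ (Fintype.card V : ℝ) ^ 7 * closedWalkFive D := by
  have hs : ∀ x y, D x y = D y x := fun x y => congrFun (congrFun hD.symm x) y
  have h1 : (∑ z, ∑ x, ∑ y, D z x * D z y * D x y) ^ 4
      ≤ (Fintype.card V : ℝ) ^ 3 * ∑ z, (∑ x, ∑ y, D z x * D z y * D x y) ^ 4 := by
    have := pow_sum_div_card_le_sum_pow (s := (univ : Finset V))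
      (f := fun z => ∑ x, ∑ y, D z x * D z y * D x y) (fun z _ =>
        sum_nonneg fun x _ => sum_nonneg fun y _ =>
          mul_nonneg (mul_nonneg (hD0 _ _) (hD0 _ _)) (hD0 _ _)) 3
    rcases isEmpty_or_nonempty V with hV | hV
    · simp
    · rw [div_le_iff₀ (by simp; positivity)] at this
      simpa [mul_comm] using this
  refine h1.trans ?_
  have h2 : ∀ z, (∑ x, ∑ y, D z x * D z y * D x y) ^ 4 ≤ (Fintype.card V : ℝ) ^ 4 *
      ∑ y, ∑ w, ∑ x, ∑ v, D w y * (D x w * (D x v * D v z) * D y z) := by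
    intro z
    refine (sum_pow_four_le (fun x y => D z x * D z y * D x y) ?_).trans ?_
    · ext x y
      change D z y * D z x * D y x = D z x * D z y * D x y
      rw [hs y x]; ring
    refine mul_le_mul_of_nonneg_left ?_ (by positivity)
    refine sum_le_sum fun y _ => sum_le_sum fun w _ => sum_le_sum fun x _ =>
      sum_le_sum fun v _ => ?_
    have hm : ∀ {a b : ℝ}, 0 ≤ a ∧ a ≤ 1 → 0 ≤ b ∧ b ≤ 1 → 0 ≤ a * b ∧ a * b ≤ 1 :=
      fun ha hb => ⟨mul_nonneg ha.1 hb.1, mul_le_one₀ ha.2 hb.1 hb.2⟩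
    have hDD : ∀ x y, 0 ≤ D x y ∧ D x y ≤ 1 := fun x y => ⟨hD0 x y, hD1 x y⟩
    have hR := hm (hm (hm (hDD z y) (hDD z v)) (hm (hm (hDD z w) (hDD z w))
      (hm (hDD z x) (hDD z x)))) (hDD v y)
    have hL := hm (hDD w y) (hm (hm (hDD x w) (hm (hDD x v) (hDD v z))) (hDD y z))
    calc _ = (D w y * (D x w * (D x v * D v z) * D y z)) *
          (D z y * D z v * (D z w * D z w * (D z x * D z x)) * D v y) := by
          rw [hs y w, hs w x, hs v z, hs y z]; ring
      _ ≤ _ := mul_le_of_le_one_right hL.1 hR.2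
  calc _ ≤ (Fintype.card V : ℝ) ^ 3 * ∑ z, ((Fintype.card V : ℝ) ^ 4 *
      ∑ y, ∑ w, ∑ x, ∑ v, D w y * (D x w * (D x v * D v z) * D y z)) :=
        mul_le_mul_of_nonneg_left (sum_le_sum fun z _ => h2 z) (by positivity)
    _ = (Fintype.card V : ℝ) ^ 7 *
        ∑ z, ∑ y, ∑ w, ∑ x, ∑ v, D w y * (D x w * (D x v * D v z) * D y z) := by
        rw [← mul_sum]; ring
    _ = _ := by
        congr 1
        simp only [closedWalkFive, mul_apply, mul_sum, sum_mul]
        rw [sum_comm]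
        refine sum_congr rfl fun y _ => ?_
        rw [sum_comm]
        refine sum_congr rfl fun w _ => ?_
        rw [sum_comm]

lemma card_cliqueFinset_three_le [DecidableEq V] (G : SimpleGraph V) [DecidableRel G.Adj] :
    (#(G.cliqueFinset 3) : ℝ)
      ≤ ∑ z, ∑ x, ∑ y, G.adjMatrix ℝ z x * G.adjMatrix ℝ z y * G.adjMatrix ℝ x y := by
  have h1 : ∑ z, ∑ x, ∑ y, G.adjMatrix ℝ z x * G.adjMatrix ℝ z y * G.adjMatrix ℝ x y
      = #{p : V × V × V | G.Adj p.1 p.2.1 ∧ G.Adj p.1 p.2.2 ∧ G.Adj p.2.1 p.2.2} := by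
    rw [card_filter, Nat.cast_sum, Fintype.sum_prod_type]
    simp only [Fintype.sum_prod_type, SimpleGraph.adjMatrix_apply]
    refine sum_congr rfl fun z _ => sum_congr rfl fun x _ => sum_congr rfl fun y _ => ?_
    by_cases h1 : G.Adj z x <;> by_cases h2 : G.Adj z y <;> by_cases h3 : G.Adj x y <;>
      simp [h1, h2, h3]
  rw [h1]
  refine Nat.cast_le.2 (card_le_card_of_surjOn (fun p : V × V × V => {p.1, p.2.1, p.2.2}) ?_)
  intro s hs
  rw [mem_coe, SimpleGraph.mem_cliqueFinset_iff, SimpleGraph.is3Clique_iff] at hs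
  obtain ⟨a, b, c, hab, hac, hbc, rfl⟩ := hs
  exact ⟨(a, b, c), by simp [hab, hac, hbc], rfl⟩

/-- Summing over `z` undoes the averaging in that coordinate; the other two averages turn the
marginal bound by `A` into one by `blockAvg c A`. It is applied to each pair of coordinates of the
packing. -/
lemma sum_prod_avg {k : ℕ} (c : V → Fin k) (f : V → V → V → ℝ) {A : Matrix V V ℝ}
    (h : ∀ x y, ∑ z, f x y z ≤ A x y) (x y : V) :
    ∑ z, ∑ x', ∑ y', ∑ z', cellAvg c x x' * cellAvg c y y' * cellAvg c z z' * f x' y' z'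
      ≤ blockAvg c A x y := by
  rw [blockAvg_apply, sum_comm]
  refine sum_le_sum fun x' _ => ?_
  rw [sum_comm]
  refine sum_le_sum fun y' _ => ?_
  rw [sum_comm]
  have : ∀ z', ∑ z, cellAvg c x x' * cellAvg c y y' * cellAvg c z z' * f x' y' z'
      = cellAvg c x x' * cellAvg c y y' * f x' y' z' := by
    intro z'
    rw [← sum_mul, ← mul_sum]
    simp only [cellAvg_comm c _ z', cellAvg_row_sum, mul_one]
  rw [sum_congr rfl fun z' _ => this z', ← mul_sum]
  calc _ ≤ cellAvg c x x' * cellAvg c y y' * A x' y' :=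
        mul_le_mul_of_nonneg_left (h x' y') (mul_nonneg (cellAvg_nonneg _ _ _)
          (cellAvg_nonneg _ _ _))
    _ = _ := by ring

open Classical in
/-- A fractional triangle packing forces the block averages to have much mass on the non-edges
of any triangle-free graph. -/
lemma card_le_three_mul_sum_nonadj {k : ℕ} (c : V → Fin k) {A : Matrix V V ℝ}
    (T : Finset (V × V × V))
    (h12 : ∀ x y, (#{z | (x, y, z) ∈ T} : ℝ) ≤ A x y)
    (h13 : ∀ x z, (#{y | (x, y, z) ∈ T} : ℝ) ≤ A x z)
    (h23 : ∀ y z, (#{x | (x, y, z) ∈ T} : ℝ) ≤ A y z)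
    {H : SimpleGraph V} (hH : H.CliqueFree 3) :
    (#T : ℝ) ≤ 3 * ∑ x, ∑ y, if H.Adj x y then 0 else blockAvg c A x y := by
  let f : V → V → V → ℝ := fun x y z => if (x, y, z) ∈ T then 1 else 0
  let g : V → V → V → ℝ := fun x y z =>
    ∑ x', ∑ y', ∑ z', cellAvg c x x' * cellAvg c y y' * cellAvg c z z' * f x' y' z'
  have hg0 : ∀ x y z, 0 ≤ g x y z := fun x y z => sum_nonneg fun x' _ => sum_nonneg fun y' _ =>
    sum_nonneg fun z' _ => mul_nonneg (mul_nonneg (mul_nonneg (cellAvg_nonneg _ _ _)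
      (cellAvg_nonneg _ _ _)) (cellAvg_nonneg _ _ _)) (by simp only [f]; split_ifs <;> norm_num)
  have g12 : ∀ x y, ∑ z, g x y z ≤ blockAvg c A x y := fun x y =>
    sum_prod_avg c f (fun x y => by simpa [f] using h12 x y) x y
  have g13 : ∀ x z, ∑ y, g x y z ≤ blockAvg c A x z := by
    intro x z
    refine le_trans (le_of_eq (sum_congr rfl fun y _ => ?_))
      (sum_prod_avg c (fun x z y => f x y z) (fun x z => by simpa [f] using h13 x z) x z)
    refine sum_congr rfl fun x' _ => ?_
    rw [sum_comm]
    exact sum_congr rfl fun z' _ => sum_congr rfl fun y' _ => by ring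
  have g23 : ∀ y z, ∑ x, g x y z ≤ blockAvg c A y z := by
    intro y z
    refine le_trans (le_of_eq (sum_congr rfl fun x _ => ?_))
      (sum_prod_avg c (fun y z x => f x y z) (fun y z => by simpa [f] using h23 y z) y z)
    simp only [g]
    rw [sum_comm]
    refine sum_congr rfl fun y' _ => ?_
    rw [sum_comm]
    exact sum_congr rfl fun z' _ => sum_congr rfl fun x' _ => by ring
  have tot : (#T : ℝ) = ∑ x, ∑ y, ∑ z, g x y z := by
    have e0 : (#T : ℝ) = ∑ x, ∑ y, ∑ z, f x y z := by
      have : (#T : ℝ) = ∑ p : V × V × V, if p ∈ T then (1 : ℝ) else 0 := by simp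
      rw [this, Fintype.sum_prod_type]
      simp only [Fintype.sum_prod_type, f]
    have swap : ∀ F : V → V → V → ℝ, ∑ x, ∑ x', cellAvg c x x' * (∑ y, ∑ z, F x' y z)
        = ∑ x, ∑ y, ∑ z, F x y z := by
      intro F
      rw [sum_comm]
      refine sum_congr rfl fun x' _ => ?_
      rw [← sum_mul]
      simp only [cellAvg_comm c _ x', cellAvg_row_sum, one_mul]
    have one : ∀ z, ∑ x, cellAvg c x z = 1 := fun z => by
      simp only [cellAvg_comm c _ z, cellAvg_row_sum]
    rw [e0]
    symm
    calc ∑ x, ∑ y, ∑ z, g x y z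
        = ∑ x', ∑ y', ∑ z', ∑ x, ∑ y, ∑ z,
            cellAvg c x x' * cellAvg c y y' * cellAvg c z z' * f x' y' z' := by
          simp only [g, ← Fintype.sum_prod_type' (f := fun a b => ∑ z, ∑ x', ∑ y', ∑ z',
            cellAvg c a x' * cellAvg c b y' * cellAvg c z z' * f x' y' z')]
          rw [← Fintype.sum_prod_type' (f := fun (p : V × V) z => ∑ x', ∑ y', ∑ z',
            cellAvg c p.1 x' * cellAvg c p.2 y' * cellAvg c z z' * f x' y' z'), sum_comm]
          refine sum_congr rfl fun x' _ => ?_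
          rw [sum_comm]
          refine sum_congr rfl fun y' _ => ?_
          rw [sum_comm]
          refine sum_congr rfl fun z' _ => ?_
          simp only [Fintype.sum_prod_type]
      _ = _ := by
          refine sum_congr rfl fun x' _ => sum_congr rfl fun y' _ => sum_congr rfl fun z' _ => ?_
          simp only [← sum_mul, ← mul_sum, one, mul_one, one_mul]
  -- Since `H` is triangle-free, at least one of the three pairs is a non-edge and carries the full
  -- weight of the triple.
  have pt : ∀ x y z, g x y z ≤ (if H.Adj x y then 0 else g x y z)
      + (if H.Adj x z then 0 else g x y z) + (if H.Adj y z then 0 else g x y z) := by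
    intro x y z
    have h0 := hg0 x y z
    by_cases h1 : H.Adj x y <;> by_cases h2 : H.Adj x z <;> by_cases h3 : H.Adj y z <;>
      simp only [h1, h2, h3, if_true, if_false]
    · exact absurd (SimpleGraph.is3Clique_triple_iff.2 ⟨h1, h2, h3⟩) (hH _)
    all_goals linarith
  have b12 : ∑ x, ∑ y, ∑ z, (if H.Adj x y then 0 else g x y z)
      ≤ ∑ x, ∑ y, if H.Adj x y then 0 else blockAvg c A x y := by
    refine sum_le_sum fun x _ => sum_le_sum fun y _ => ?_
    split_ifs
    · simp
    · exact g12 x y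
  have b13 : ∑ x, ∑ y, ∑ z, (if H.Adj x z then 0 else g x y z)
      ≤ ∑ x, ∑ y, if H.Adj x y then 0 else blockAvg c A x y := by
    refine sum_le_sum fun x _ => ?_
    rw [sum_comm]
    refine sum_le_sum fun z _ => ?_
    split_ifs
    · simp
    · exact g13 x z
  have b23 : ∑ x, ∑ y, ∑ z, (if H.Adj y z then 0 else g x y z)
      ≤ ∑ x, ∑ y, if H.Adj x y then 0 else blockAvg c A x y := by
    rw [sum_comm]
    refine sum_le_sum fun y _ => ?_
    rw [sum_comm]
    refine sum_le_sum fun z _ => ?_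
    split_ifs
    · simp
    · exact g23 y z
  rw [tot]
  calc _ ≤ ∑ x, ∑ y, ∑ z, ((if H.Adj x y then 0 else g x y z)
      + (if H.Adj x z then 0 else g x y z) + (if H.Adj y z then 0 else g x y z)) :=
        sum_le_sum fun x _ => sum_le_sum fun y _ => sum_le_sum fun z _ => pt x y z
    _ ≤ _ := by simp only [sum_add_distrib]; linarith

lemma card_adj_pairs [DecidableEq V] (G : SimpleGraph V) [DecidableRel G.Adj] :
    #{p : V × V | G.Adj p.1 p.2} = 2 * #G.edgeFinset := by
  rw [← SimpleGraph.sum_degrees_eq_twice_card_edges, card_filter, Fintype.sum_prod_type]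
  refine sum_congr rfl fun x _ => ?_
  rw [← card_filter, ← SimpleGraph.card_neighborFinset_eq_degree]
  congr 1
  ext y; simp

end DenseTriangles

/-! ### From a triangle packing to many second-neighbourhood edges -/

section Core
variable {V : Type*} [Fintype V]

open Classical in
/-- The graph of pairs on which a symmetric matrix is at least `β`. -/
noncomputable def thresholdGraph (B : Matrix V V ℝ) (hB : Bᵀ = B) (β : ℝ) : SimpleGraph V where
  Adj x y := x ≠ y ∧ β ≤ B x y
  symm := ⟨fun x y h => ⟨h.1.symm, by
    have : B y x = B x y := congrFun (congrFun hB x) y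
    rw [this]; exact h.2⟩⟩
  loopless := ⟨fun _ h => h.1 rfl⟩

open Classical in
-- For a triangle-free subgraph `H`, the packing puts mass at least `(ε / 3) r³` outside `H`.
-- Entries below the threshold carry at most `n² * ε / (6 r)`, half of this. The rest sits on the
-- diagonal or on deleted edges, and by Cauchy–Schwarz with energy at most `2 n` this set has at
-- least `ε² n² / 72` ordered pairs. The diagonal takes at most half of them, by `hn0`, and ordered
-- pairs count each edge twice, hence `288`.
lemma farFromTriangleFree_thresholdGraph {k : ℕ} (c : V → Fin k) {A : Matrix V V ℝ}
    (hA : Aᵀ = A) (hA0 : ∀ x y, 0 ≤ A x y) (T : Finset (V × V × V))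
    (h12 : ∀ x y, (#{z | (x, y, z) ∈ T} : ℝ) ≤ A x y)
    (h13 : ∀ x z, (#{y | (x, y, z) ∈ T} : ℝ) ≤ A x z)
    (h23 : ∀ y z, (#{x | (x, y, z) ∈ T} : ℝ) ≤ A y z)
    {n r ε : ℝ} (hn : n = Fintype.card V) (hr : 0 < r) (hrn : r ^ 2 = n) (hε : 0 < ε)
    (hE : blockEnergy c A ≤ 2 * n) (hT : ε * r ^ 3 ≤ #T) (hn0 : 144 / ε ^ 2 ≤ n) :
    (thresholdGraph (blockAvg c A) (blockAvg_transpose c hA) (ε / 6 / r)).FarFromTriangleFree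
      (ε ^ 2 / 288) := by
  set B := blockAvg c A with hBdef
  have hB0 : ∀ x y, 0 ≤ B x y := blockAvg_nonneg c hA0
  set D := thresholdGraph B (blockAvg_transpose c hA) (ε / 6 / r) with hD
  rw [SimpleGraph.farFromTriangleFree_iff]
  intro H _ hHD hH
  have h1 : (#T : ℝ) ≤ 3 * ∑ x, ∑ y, if H.Adj x y then 0 else B x y := by
    convert card_le_three_mul_sum_nonadj c T h12 h13 h23 hH
  let Z : Finset (V × V) := {p | p.1 = p.2 ∨ (D.Adj p.1 p.2 ∧ ¬ H.Adj p.1 p.2)}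
  have h2 : ∑ x, ∑ y, (if H.Adj x y then 0 else B x y) ≤ ε / 6 * r ^ 3 + ∑ p ∈ Z, B p.1 p.2 := by
    calc ∑ x, ∑ y, (if H.Adj x y then 0 else B x y)
        = ∑ p : V × V, (if H.Adj p.1 p.2 then 0 else B p.1 p.2) := by
          rw [Fintype.sum_prod_type]
      _ ≤ ∑ p : V × V, (ε / 6 / r + if p ∈ Z then B p.1 p.2 else 0) := by
          refine sum_le_sum fun p _ => ?_
          have hpos : 0 ≤ ε / 6 / r := by positivity
          have hp := hB0 p.1 p.2
          by_cases hp1 : H.Adj p.1 p.2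
          · simp only [hp1, if_true]; split_ifs <;> linarith
          · simp only [hp1, if_false]
            by_cases hz : p ∈ Z
            · simp only [hz, if_true]; linarith
            · simp only [hz, if_false]
              simp only [Z, mem_filter, mem_univ, true_and, not_or, not_and, not_not] at hz
              have : ¬ D.Adj p.1 p.2 := fun h => hp1 (hz.2 h)
              have : ¬ (ε / 6 / r ≤ B p.1 p.2) := fun h => this ⟨hz.1, h⟩
              linarith
      _ = n ^ 2 * (ε / 6 / r) + ∑ p ∈ Z, B p.1 p.2 := by
          rw [sum_add_distrib, sum_ite_mem, univ_inter, sum_const, card_univ, nsmul_eq_mul, hn]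
          simp [sq]
      _ = _ := by
          rw [← hrn]; field_simp
  have h3 : (∑ p ∈ Z, B p.1 p.2) ^ 2 ≤ #Z * (2 * n) := by
    refine (sq_sum_le_card_mul_sum_sq).trans (mul_le_mul_of_nonneg_left ?_ (by positivity))
    refine le_trans ?_ hE
    rw [blockEnergy, ← Fintype.sum_prod_type' (f := fun x y => blockAvg c A x y ^ 2)]
    exact sum_le_sum_of_subset_of_nonneg (subset_univ _) fun p _ _ => sq_nonneg _
  have h4 : ε / 6 * r ^ 3 ≤ ∑ p ∈ Z, B p.1 p.2 := by linarith
  have hnpos : 0 < n := by rw [← hrn]; positivity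
  have h5 : ε ^ 2 / 72 * n ^ 2 ≤ #Z := by
    have h6 := (pow_le_pow_left₀ (by positivity) h4 2).trans h3
    have e : (ε / 6 * r ^ 3) ^ 2 = (ε ^ 2 / 72 * n ^ 2) * (2 * n) := by rw [← hrn]; ring
    rw [e] at h6
    exact le_of_mul_le_mul_right h6 (by positivity)
  have h6 : (#Z : ℝ) ≤ n + (2 * #D.edgeFinset - 2 * #H.edgeFinset) := by
    have c1 : Z ⊆ univ.image (fun x : V => (x, x)) ∪
        (({p | D.Adj p.1 p.2} : Finset (V × V)) \ ({p | H.Adj p.1 p.2} : Finset (V × V))) := by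
      rintro ⟨x, y⟩ hp
      simp only [Z, mem_filter, mem_univ, true_and] at hp
      simp only [mem_union, mem_image, mem_univ, true_and, mem_sdiff, mem_filter]
      exact hp.imp (fun h => ⟨x, by simp_all⟩) id
    have c2 := (card_le_card c1).trans (card_union_le _ _)
    have c3 : ({p | H.Adj p.1 p.2} : Finset (V × V)) ⊆ ({p | D.Adj p.1 p.2} : Finset (V × V)) :=
      fun p hp => by
        simp only [mem_filter, mem_univ, true_and] at hp ⊢
        exact hHD hp
    have c4 := card_sdiff_add_card_eq_card c3
    rw [card_adj_pairs D, card_adj_pairs H] at c4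
    have c5 : #(univ.image (fun x : V => (x, x))) ≤ Fintype.card V := card_image_le
    have c6 : #Z + 2 * #H.edgeFinset ≤ Fintype.card V + 2 * #D.edgeFinset := by omega
    have c7 : (#Z : ℝ) + 2 * #H.edgeFinset ≤ Fintype.card V + 2 * #D.edgeFinset := by
      exact_mod_cast c6
    rw [hn]; linarith
  have h7 : 144 ≤ ε ^ 2 * n := by rwa [div_le_iff₀' (by positivity)] at hn0
  have h8 : 144 * n ≤ ε ^ 2 * n ^ 2 := by nlinarith
  push_cast
  rw [← hn]
  linarith

/-- In a sparse symmetric matrix of bounded degrees, whose codegrees are essentially at most one, a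
large edge-disjoint family of triangles forces many edges between second neighbourhoods. -/
theorem exists_many_second_neighborhood_edges {ε K : ℝ} (hε : 0 < ε) (hK : 0 < K) :
    ∃ κ > 0, ∃ ω > 0, ∃ n₀ : ℕ, ∀ (V : Type u) [Fintype V], n₀ ≤ Fintype.card V →
      ∀ (r : ℝ), 0 < r → r ^ 2 = Fintype.card V →
      ∀ (A U : Matrix V V ℝ), Aᵀ = A → (∀ x y, 0 ≤ A x y) → (∀ x, ∑ y, A x y ≤ K * r) →
      (∀ x y, 0 ≤ U x y) → (∀ x y, U x y ≤ 1) → (∀ x y, U x y ≤ (A * A) x y) →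
      (∀ x, ∑ y, ((A * A) x y - U x y) ≤ ω * r ^ 2) →
      ∀ (T : Finset (V × V × V)) [DecidableEq V],
      (∀ x y, (#{z | (x, y, z) ∈ T} : ℝ) ≤ A x y) →
      (∀ x z, (#{y | (x, y, z) ∈ T} : ℝ) ≤ A x z) →
      (∀ y z, (#{x | (x, y, z) ∈ T} : ℝ) ≤ A y z) →
      ε * r ^ 3 ≤ #T →
      κ * r ^ 5 ≤ ∑ x, ∑ y, ∑ z, U x y * A y z * U x z := by
  classical
  obtain ⟨c, hc⟩ : ∃ c, c = ε / 6 := ⟨_, rfl⟩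
  have hc0 : 0 < c := by rw [hc]; positivity
  obtain ⟨δ, hδ⟩ : ∃ δ, δ = SimpleGraph.triangleRemovalBound (ε ^ 2 / 288) := ⟨_, rfl⟩
  have hδ0 : 0 < δ := by rw [hδ]; exact SimpleGraph.triangleRemovalBound_pos (by positivity)
  -- The main term will be `2 κ r⁵`. The constants `η` and `ω` make the cut-norm error and the
  -- codegree error at most `κ / 2 * r⁵` each, with `L` collecting the powers of `c` in the counting
  -- lemma.
  obtain ⟨κ, hκ⟩ : ∃ κ, κ = c ^ 5 * δ ^ 4 / 2 := ⟨_, rfl⟩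
  have hκ0 : 0 < κ := by rw [hκ]; positivity
  obtain ⟨L, hL⟩ : ∃ L, L = c ^ 3 + c := ⟨_, rfl⟩
  have hL0 : 0 < L := by rw [hL]; positivity
  obtain ⟨η, hη⟩ : ∃ η, η = κ / 2 / (1 + 2 * K * L) := ⟨_, rfl⟩
  have hη0 : 0 < η := by rw [hη]; positivity
  -- The energy is at most `2 r²` and each refinement gains more than `η² r²`, so `m` rounds
  -- suffice. The bound `ω ≤ 1 / 4 ^ m` keeps the energy below `2 r²` for every partition into at
  -- most `4 ^ m` classes.
  obtain ⟨m, hm⟩ := exists_nat_gt (2 / η ^ 2)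
  have hm' : 2 < m * η ^ 2 := by rwa [div_lt_iff₀ (by positivity)] at hm
  obtain ⟨ω, hω⟩ : ∃ ω : ℝ, ω = min (1 / 4 ^ m) (κ / 2 / L) := ⟨_, rfl⟩
  have hω0 : 0 < ω := by rw [hω]; exact lt_min (by positivity) (by positivity)
  have hω1 : ω * 4 ^ m ≤ 1 := by
    rw [← le_div_iff₀ (by positivity), hω]; exact min_le_left _ _
  have hω2 : ω * L ≤ κ / 2 := by
    rw [← le_div_iff₀ (by positivity), hω]; exact min_le_right _ _
  obtain ⟨n₀, hn₀⟩ := exists_nat_ge (144 / ε ^ 2)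
  refine ⟨κ, hκ0, ω, hω0, n₀, ?_⟩
  intro V _ hV r hr hrn A U hA hA0 hAd hU0 hU1 hUA hAU T _ h12 h13 h23 hT
  have hn : (144 / ε ^ 2 : ℝ) ≤ Fintype.card V := hn₀.trans (by exact_mod_cast hV)
  have hE : ∀ k ≤ 4 ^ m, ∀ c : V → Fin k, blockEnergy c A ≤ 2 * r ^ 2 := by
    intro k hk c
    have h1 := blockEnergy_le c (e := fun x y => (A * A) x y - U x y) hA
      (fun x y => by linarith [hUA x y]) (fun x y => by linarith [hU1 x y]) hAU (by positivity)
    rw [← hrn] at h1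
    have h2 : (k : ℝ) ≤ 4 ^ m := by exact_mod_cast hk
    have h3 : (k : ℝ) * (ω * r ^ 2) ≤ 1 * r ^ 2 := by
      rw [← mul_assoc]
      refine mul_le_mul_of_nonneg_right ?_ (by positivity)
      calc (k : ℝ) * ω ≤ 4 ^ m * ω := mul_le_mul_of_nonneg_right h2 hω0.le
        _ ≤ 1 := by linarith
    linarith
  obtain ⟨k, hk, col, hcol⟩ := exists_weak_regular_coloring hA (m := m) (E := 2 * r ^ 2)
    (t := η ^ 2 * r ^ 2) (by nlinarith [sq_pos_of_pos hr]) hE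
  have hcut : ∀ S T : Finset V, |∑ x ∈ S, ∑ y ∈ T, (A x y - blockAvg col A x y)| ≤ η * r ^ 3 := by
    intro S T
    refine abs_le_of_sq_le_sq ?_ (by positivity)
    refine (hcol S T).trans (le_of_eq ?_)
    rw [← hrn]; ring
  have hBt := blockAvg_transpose col hA
  set D := thresholdGraph (blockAvg col A) hBt (ε / 6 / r) with hD
  have hfar := farFromTriangleFree_thresholdGraph col hA hA0 T
    (fun x y => by convert h12 x y) (fun x y => by convert h13 x y)
    (fun x y => by convert h23 x y) rfl hr hrn hε (by rw [← hrn]; exact hE k hk col) hT hn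
  have hcl := hfar.le_card_cliqueFinset
  rw [← hδ] at hcl
  have hDt : (D.adjMatrix ℝ)ᵀ = D.adjMatrix ℝ := D.transpose_adjMatrix
  have hD0 : ∀ x y, 0 ≤ D.adjMatrix ℝ x y := fun x y => by
    rw [SimpleGraph.adjMatrix_apply]; split_ifs <;> norm_num
  have hD1 : ∀ x y, D.adjMatrix ℝ x y ≤ 1 := fun x y => by
    rw [SimpleGraph.adjMatrix_apply]; split_ifs <;> norm_num
  have hW : δ ^ 4 * r ^ 10 ≤ closedWalkFive (D.adjMatrix ℝ) := by
    have h1 := triangle_pow_four_le_closedWalkFive hDt hD0 hD1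
    have h2 := hcl.trans (card_cliqueFinset_three_le D)
    have h3 := (pow_le_pow_left₀ (by positivity) h2 4).trans h1
    rw [← hrn] at h3
    have e : (δ * (r ^ 2) ^ 3) ^ 4 = (r ^ 2) ^ 7 * (δ ^ 4 * r ^ 10) := by ring
    rw [e] at h3
    exact le_of_mul_le_mul_left h3 (by positivity)
  have hDB : ∀ x y, c / r * D.adjMatrix ℝ x y ≤ blockAvg col A x y := by
    intro x y
    rw [SimpleGraph.adjMatrix_apply]
    split_ifs with h
    · rw [mul_one, hc]; exact h.2
    · rw [mul_zero]; exact blockAvg_nonneg col hA0 x y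
  have hcount := count_ge_closedWalkFive (d := K * r) (τ := η * r ^ 3) (ω := ω * r ^ 4)
    (β := c / r) hA hBt hA0 (blockAvg_nonneg col hA0)
    (by positivity) (by positivity) (by positivity) (by positivity) hAd
    (blockAvg_row_sum_le col hAd) hcut hU0 hU1 hUA (by
      calc ∑ x, ∑ y, ((A * A) x y - U x y) ≤ ∑ _x : V, ω * r ^ 2 := sum_le_sum fun x _ => hAU x
        _ = ω * r ^ 4 := by rw [sum_const, card_univ, nsmul_eq_mul, ← hrn]; ring) hD0 hD1 hDB
  refine le_trans ?_ hcount
  rw [← hrn]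
  have hmain : c ^ 5 * δ ^ 4 * r ^ 5 ≤ (c / r) ^ 5 * closedWalkFive (D.adjMatrix ℝ) := by
    calc _ = (c / r) ^ 5 * (δ ^ 4 * r ^ 10) := by field_simp
      _ ≤ _ := mul_le_mul_of_nonneg_left hW (by positivity)
  have e1 : (c / r) ^ 3 * (r ^ 2) ^ 2 * (2 * (K * r) * (η * r ^ 3) + ω * r ^ 4)
      + c / r * r ^ 2 * (2 * (K * r) * (η * r ^ 3) + ω * r ^ 4) + r ^ 2 * (η * r ^ 3)
      = (η * (1 + 2 * K * L) + ω * L) * r ^ 5 := by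
    rw [hL]; field_simp; ring
  have e2 : η * (1 + 2 * K * L) = κ / 2 := by rw [hη]; field_simp
  have e3 : (η * (1 + 2 * K * L) + ω * L) * r ^ 5 ≤ κ * r ^ 5 :=
    mul_le_mul_of_nonneg_right (by linarith) (by positivity)
  have e4 : c ^ 5 * δ ^ 4 * r ^ 5 = 2 * κ * r ^ 5 := by rw [hκ]; ring
  linarith

end Core

/-! ### Labelled 5-cycles and copies of `C₅` -/

section Pentagons
variable {V : Type*}

/-- A labelled 5-cycle in a graph. -/
def IsPentagon (G : SimpleGraph V) (v : Fin 5 → V) : Prop :=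
  Function.Injective v ∧ ∀ i, G.Adj (v i) (v (i + 1))

lemma isPentagon_of_adj {G : SimpleGraph V} {a b c d e : V} (hab : G.Adj a b) (hbc : G.Adj b c)
    (hcd : G.Adj c d) (hde : G.Adj d e) (hea : G.Adj e a) (hac : a ≠ c) (had : a ≠ d)
    (hbd : b ≠ d) (hbe : b ≠ e) (hce : c ≠ e) : IsPentagon G ![a, b, c, d, e] := by
  refine ⟨?_, ?_⟩
  · have h1 := hab.ne
    have h2 := hbc.ne
    have h3 := hcd.ne
    have h4 := hde.ne
    have h5 := hea.ne
    intro i j hij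
    fin_cases i <;> fin_cases j <;> simp_all
  · intro i
    fin_cases i
    · exact hab
    · exact hbc
    · exact hcd
    · exact hde
    · exact hea

/-- The copy of the 5-cycle given by a labelled 5-cycle. -/
def IsPentagon.copy {G : SimpleGraph V} {v : Fin 5 → V} (hv : IsPentagon G v) :
    (SimpleGraph.cycleGraph 5).Copy G where
  toHom := ⟨v, by
    intro a b hab
    rw [SimpleGraph.cycleGraph_adj] at hab
    rcases hab with h | h
    · have : a = b + 1 := sub_eq_iff_eq_add'.1 h
      rw [this]; exact (hv.2 b).symm
    · have : b = a + 1 := sub_eq_iff_eq_add'.1 h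
      rw [this]; exact hv.2 a⟩
  injective' := hv.1

open Classical in
/-- Tuples of `j` vertices each lying on a common 5-cycle are counted by copies of the 5-cycle. -/
lemma card_le_pow_mul_copyCount [Fintype V] {ι : Type*} {j : ℕ} (G : SimpleGraph V) (s : Finset ι)
    (f : ι → Fin j → V) (hf : Function.Injective f)
    (h : ∀ i ∈ s, ∃ v, IsPentagon G v ∧ ∀ l, f i l ∈ Set.range v) :
    #s ≤ 5 ^ j * G.copyCount (SimpleGraph.cycleGraph 5) := by
  choose v hv hfv using h
  let g : ι → G.Subgraph := fun i => if hi : i ∈ s then (hv i hi).copy.toSubgraph else ⊥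
  have hg : ∀ i (hi : i ∈ s), g i = (hv i hi).copy.toSubgraph := fun i hi => by simp [g, hi]
  have hverts : ∀ i (hi : i ∈ s), (g i).verts = Set.range (v i hi) := fun i hi => by
    rw [hg i hi]
    ext x
    simp only [SimpleGraph.Copy.toSubgraph, SimpleGraph.Subgraph.map_verts,
      SimpleGraph.Subgraph.verts_top, Set.image_univ]
    rfl
  rw [SimpleGraph.copyCount]
  -- All tuples assigned to the same subgraph have their entries among its five vertices, so each
  -- fibre has at most `5 ^ j` elements.
  refine card_le_mul_card_image_of_maps_to (f := g) (fun i hi => ?_) _ (fun b hb => ?_)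
  · simp only [mem_filter, mem_univ, true_and]
    rw [hg i hi]
    exact ⟨(hv i hi).copy.isoToSubgraph⟩
  · rcases ({a ∈ s | g a = b} : Finset ι).eq_empty_or_nonempty with h0 | ⟨i, hi⟩
    · rw [h0]; simp
    · obtain ⟨hi1, hi2⟩ := mem_filter.1 hi
      have hb : b.verts = ↑(univ.image (v i hi1)) := by
        rw [← hi2, hverts i hi1]; simp
      calc #{a ∈ s | g a = b} ≤ #(Fintype.piFinset fun _ : Fin j => univ.image (v i hi1)) := by
            refine card_le_card_of_injOn f (fun a ha => ?_) hf.injOn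
            rw [mem_coe, mem_filter] at ha
            rw [mem_coe, Fintype.mem_piFinset]
            intro l
            have := hfv a ha.1 l
            rw [← hverts a ha.1, ha.2, hb] at this
            exact_mod_cast this
        _ = 5 ^ j := by
            rw [Fintype.card_piFinset, prod_const, card_image_of_injective _ (hv i hi1).1]
            simp

end Pentagons

/-! ### Edge-disjoint triangle families -/

section TriangleSystems
variable {V : Type*}

/-- A family of edge-disjoint triangles of a graph, each recorded with all its orderings. -/
structure IsTriangleSystem (G : SimpleGraph V) (T : Finset (V × V × V)) : Prop where
  adj : ∀ {x y z}, (x, y, z) ∈ T → G.Adj x y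
  swap : ∀ {x y z}, (x, y, z) ∈ T → (y, x, z) ∈ T
  rot : ∀ {x y z}, (x, y, z) ∈ T → (y, z, x) ∈ T
  uniq : ∀ {x y z z'}, (x, y, z) ∈ T → (x, y, z') ∈ T → z = z'

namespace IsTriangleSystem
variable {G : SimpleGraph V} {T : Finset (V × V × V)}

lemma swap_right (hT : IsTriangleSystem G T) {x y z : V} (h : (x, y, z) ∈ T) : (x, z, y) ∈ T :=
  hT.rot (hT.swap h)

/-- The union of the triangles of a triangle system. -/
def graph (hT : IsTriangleSystem G T) : SimpleGraph V where
  Adj x y := ∃ z, (x, y, z) ∈ T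
  symm := ⟨fun _ _ ⟨z, h⟩ => ⟨z, hT.swap h⟩⟩
  loopless := ⟨fun _ ⟨_, h⟩ => (hT.adj h).ne rfl⟩

lemma graph_le (hT : IsTriangleSystem G T) : hT.graph ≤ G := fun _ _ ⟨_, h⟩ => hT.adj h

lemma graph_mono (hT : IsTriangleSystem G T) {T' : Finset (V × V × V)}
    (hT' : IsTriangleSystem G T') (h : T' ⊆ T) : hT'.graph ≤ hT.graph :=
  fun _ _ ⟨z, hz⟩ => ⟨z, h hz⟩

/-- A 4-cycle of the union of a triangle system extends to a 5-cycle. -/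
lemma exists_isPentagon (hT : IsTriangleSystem G T) {x a y b : V} (hxa : hT.graph.Adj x a)
    (hay : hT.graph.Adj a y) (hyb : hT.graph.Adj y b) (hbx : hT.graph.Adj b x)
    (hxy : x ≠ y) (hab : a ≠ b) :
    ∃ v, IsPentagon G v ∧ x ∈ Set.range v ∧ y ∈ Set.range v ∧ a ∈ Set.range v ∧
      b ∈ Set.range v := by
  -- Detour from `x` to `a` through the apex `t` of their triangle. This fails only if `t` is `y` or
  -- `b`; then the detour is made at `yb`, respectively `ay`, where edge-disjointness keeps the new
  -- apex off the 4-cycle.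
  have ext : ∀ {x a y b t : V}, (x, a, t) ∈ T → hT.graph.Adj a y → hT.graph.Adj y b →
      hT.graph.Adj b x → x ≠ y → a ≠ b → t ≠ y → t ≠ b →
      ∃ v, IsPentagon G v ∧ x ∈ Set.range v ∧ y ∈ Set.range v ∧ a ∈ Set.range v ∧
      b ∈ Set.range v := by
    intro x a y b t ht hay hyb hbx hxy hab hty htb
    have hxa := hT.adj ht
    exact ⟨![x, t, a, y, b], isPentagon_of_adj (hT.adj (hT.swap_right ht))
      (hT.adj (hT.rot (hT.rot (hT.swap ht))) ) (hT.graph_le hay) (hT.graph_le hyb)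
      (hT.graph_le hbx) hxa.ne hxy hty htb hab,
      ⟨0, rfl⟩, ⟨3, rfl⟩, ⟨2, rfl⟩, ⟨4, rfl⟩⟩
  obtain ⟨t, ht⟩ := id hxa
  by_cases hty : t = y
  · subst hty
    obtain ⟨s, hs⟩ := id hyb
    have hsx : s ≠ x := by
      rintro rfl
      exact hab (hT.uniq (hT.swap_right ht) (hT.swap (hT.swap_right hs)))
    have hsa : s ≠ a := by
      rintro rfl
      exact hbx.ne (hT.uniq (hT.swap_right hs) (hT.swap (hT.rot ht)))
    obtain ⟨v, hv, h1, h2, h3, h4⟩ := ext hs hbx hxa hay hxy.symm hab.symm hsx hsa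
    exact ⟨v, hv, h2, h1, h4, h3⟩
  by_cases htb : t = b
  · subst htb
    obtain ⟨s, hs⟩ := id hay
    have hsx : s ≠ x := by
      rintro rfl
      exact hyb.ne (hT.uniq (hT.swap_right hs) (hT.swap ht))
    have hst : s ≠ t := by
      rintro rfl
      exact hxy (hT.uniq (hT.rot ht) (hT.swap_right hs))
    obtain ⟨v, hv, h1, h2, h3, h4⟩ := ext hs hyb hbx hxa hab hxy.symm hst hsx
    exact ⟨v, hv, h4, h3, h1, h2⟩
  · exact ext ht hay hyb hbx hxy hab hty htb

lemma insert [DecidableEq V] (hT : IsTriangleSystem G T) {a b c : V} (hab : G.Adj a b)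
    (hac : G.Adj a c) (hbc : G.Adj b c) (kab : ∀ z, (a, b, z) ∉ T) (kba : ∀ z, (b, a, z) ∉ T)
    (kac : ∀ z, (a, c, z) ∉ T) (kca : ∀ z, (c, a, z) ∉ T) (kbc : ∀ z, (b, c, z) ∉ T)
    (kcb : ∀ z, (c, b, z) ∉ T) : IsTriangleSystem G
      (T ∪ {(a, b, c), (a, c, b), (b, a, c), (b, c, a), (c, a, b), (c, b, a)}) := by
  have nab := hab.ne
  have nac := hac.ne
  have nbc := hbc.ne
  constructor
  · intro x y z h
    simp only [mem_union, mem_insert, mem_singleton, Prod.mk.injEq] at h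
    rcases h with h | h
    · exact hT.adj h
    · rcases h with ⟨rfl, rfl, -⟩ | ⟨rfl, rfl, -⟩ | ⟨rfl, rfl, -⟩ | ⟨rfl, rfl, -⟩ | ⟨rfl, rfl, -⟩ |
        ⟨rfl, rfl, -⟩
      exacts [hab, hac, hab.symm, hbc, hac.symm, hbc.symm]
  · intro x y z h
    simp only [mem_union, mem_insert, mem_singleton, Prod.mk.injEq] at h ⊢
    refine h.imp hT.swap fun h => ?_
    rcases h with ⟨rfl, rfl, rfl⟩ | ⟨rfl, rfl, rfl⟩ | ⟨rfl, rfl, rfl⟩ | ⟨rfl, rfl, rfl⟩ |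
        ⟨rfl, rfl, rfl⟩ | ⟨rfl, rfl, rfl⟩ <;> simp
  · intro x y z h
    simp only [mem_union, mem_insert, mem_singleton, Prod.mk.injEq] at h ⊢
    refine h.imp hT.rot fun h => ?_
    rcases h with ⟨rfl, rfl, rfl⟩ | ⟨rfl, rfl, rfl⟩ | ⟨rfl, rfl, rfl⟩ | ⟨rfl, rfl, rfl⟩ |
        ⟨rfl, rfl, rfl⟩ | ⟨rfl, rfl, rfl⟩ <;> simp
  · have new : ∀ {x y z z'}, ((x, y, z) : V × V × V) ∈
        ({(a, b, c), (a, c, b), (b, a, c), (b, c, a), (c, a, b), (c, b, a)} :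
          Finset (V × V × V)) → (x, y, z') ∉ T ∧ ((x, y, z') ∈
        ({(a, b, c), (a, c, b), (b, a, c), (b, c, a), (c, a, b), (c, b, a)} :
          Finset (V × V × V)) → z' = z) := by
      intro x y z z' h
      simp only [mem_insert, mem_singleton, Prod.mk.injEq] at h ⊢
      rcases h with ⟨rfl, rfl, rfl⟩ | ⟨rfl, rfl, rfl⟩ | ⟨rfl, rfl, rfl⟩ | ⟨rfl, rfl, rfl⟩ |
        ⟨rfl, rfl, rfl⟩ | ⟨rfl, rfl, rfl⟩ <;>
      simp [nab.symm, nac.symm, nbc.symm, *]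
    intro x y z z' h h'
    rcases mem_union.1 h with h | h <;> rcases mem_union.1 h' with h' | h'
    · exact hT.uniq h h'
    · exact absurd h (new h').1
    · exact absurd h' (new h).1
    · exact ((new h).2 h').symm

lemma filter_notMem [DecidableEq V] (hT : IsTriangleSystem G T) (W : Finset V) :
    IsTriangleSystem G {p ∈ T | p.1 ∉ W ∧ p.2.1 ∉ W ∧ p.2.2 ∉ W} := by
  constructor <;> simp only [mem_filter]
  · exact fun h => hT.adj h.1
  · exact fun h => ⟨hT.swap h.1, h.2.2.1, h.2.1, h.2.2.2⟩
  · exact fun h => ⟨hT.rot h.1, h.2.2.1, h.2.2.2, h.2.1⟩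
  · exact fun h h' => hT.uniq h.1 h'.1

end IsTriangleSystem

open Classical in
-- Take a system of maximal size and delete all its edges: a surviving triangle shares no edge with
-- the system, so its six orderings could be added.
lemma exists_isTriangleSystem [Fintype V] (G : SimpleGraph V) :
    ∃ T : Finset (V × V × V), IsTriangleSystem G T ∧ ∃ S : Finset (Sym2 V),
      (S : Set (Sym2 V)) ⊆ G.edgeSet ∧ #S ≤ #T ∧
      (G.deleteEdges (S : Set (Sym2 V))).CliqueFree 3 := by
  obtain ⟨T, hT, hmax⟩ := exists_max_image
    ({T | IsTriangleSystem G T} : Finset (Finset (V × V × V))) card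
    ⟨∅, by simp only [mem_filter, mem_univ, true_and]; constructor <;> simp⟩
  simp only [mem_filter, mem_univ, true_and] at hT hmax
  refine ⟨T, hT, T.image fun p => s(p.1, p.2.1), ?_, card_image_le, ?_⟩
  · intro e he
    simp only [coe_image, Set.mem_image, mem_coe, Prod.exists] at he
    obtain ⟨x, y, z, h, rfl⟩ := he
    exact hT.adj h
  · intro s hs
    rw [SimpleGraph.is3Clique_iff] at hs
    obtain ⟨a, b, c, hab, hac, hbc, -⟩ := hs
    have key : ∀ {x y}, (G.deleteEdges
        ((T.image fun p => s(p.1, p.2.1) : Finset (Sym2 V)) : Set (Sym2 V))).Adj x y →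
        G.Adj x y ∧ ∀ z, (x, y, z) ∉ T := by
      intro x y h
      rw [SimpleGraph.deleteEdges_adj] at h
      refine ⟨h.1, fun z hz => h.2 ?_⟩
      simp only [coe_image, Set.mem_image, mem_coe]
      exact ⟨_, hz, rfl⟩
    have kab := key hab
    have kba := key hab.symm
    have kac := key hac
    have kca := key hac.symm
    have kbc := key hbc
    have kcb := key hbc.symm
    have hT' := hT.insert kab.1 kac.1 kbc.1 kab.2 kba.2 kac.2 kca.2 kbc.2 kcb.2
    set T' := T ∪ {(a, b, c), (a, c, b), (b, a, c), (b, c, a), (c, a, b), (c, b, a)} with hTT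
    have h1 := hmax T' hT'
    have h2 : #T < #T' := card_lt_card (Finset.ssubset_iff_subset_ne.2 ⟨subset_union_left, fun h =>
      kab.2 c (by rw [h]; simp [hTT])⟩)
    omega

end TriangleSystems

/-! ### Codegrees and degenerate configurations -/

section Codegrees
open Classical
variable {V : Type*} [Fintype V]

/-- The number of common neighbours of two vertices. -/
noncomputable def codegree (H : SimpleGraph V) (x y : V) : ℕ := #{w | H.Adj x w ∧ H.Adj w y}

/-- The excess over one of the number of common neighbours of two distinct vertices. -/
noncomputable def codegreeExcess (H : SimpleGraph V) (x y : V) : ℕ :=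
  if x = y then 0 else codegree H x y - 1

/-- The indicator of pairs of distinct vertices with a common neighbour. -/
noncomputable def secondNeighbor (H : SimpleGraph V) : Matrix V V ℝ :=
  fun x y => if x ≠ y ∧ 0 < codegree H x y then 1 else 0

lemma adjMatrix_mul_self_apply (H : SimpleGraph V) (x y : V) :
    (H.adjMatrix ℝ * H.adjMatrix ℝ) x y = codegree H x y := by
  simp only [mul_apply, SimpleGraph.adjMatrix_apply, codegree, card_filter, Nat.cast_sum]
  refine sum_congr rfl fun w _ => ?_
  by_cases h1 : H.Adj x w <;> by_cases h2 : H.Adj w y <;> simp [h1, h2]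

lemma codegree_self (H : SimpleGraph V) (x : V) : codegree H x x = H.degree x := by
  rw [← SimpleGraph.card_neighborFinset_eq_degree, codegree]
  congr 1
  ext w
  simp [H.adj_comm w x]

lemma codegree_mono {H H' : SimpleGraph V} (h : H' ≤ H) (x y : V) :
    codegree H' x y ≤ codegree H x y :=
  card_le_card fun w hw => by
    simp only [mem_filter, mem_univ, true_and] at hw ⊢
    exact hw.imp (@h _ _) (@h _ _)

lemma codegreeExcess_mono {H H' : SimpleGraph V} (h : H' ≤ H) (x y : V) :
    codegreeExcess H' x y ≤ codegreeExcess H x y := by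
  unfold codegreeExcess
  split_ifs
  · rfl
  · exact Nat.sub_le_sub_right (codegree_mono h x y) 1

lemma codegree_le (H : SimpleGraph V) (x y : V) :
    codegree H x y ≤ 1 + codegreeExcess H x y + if x = y then H.degree x else 0 := by
  unfold codegreeExcess
  split_ifs with h
  · subst h; rw [codegree_self]; omega
  · omega

/-- Bounded degrees and bounded total excess at each vertex thus make `secondNeighbor H` a row-wise
`L¹` approximation of the squared adjacency matrix. -/
lemma adjMatrix_sq_sub_secondNeighbor (H : SimpleGraph V) (x y : V) :
    (H.adjMatrix ℝ * H.adjMatrix ℝ) x y - secondNeighbor H x y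
      = codegreeExcess H x y + if x = y then (H.degree x : ℝ) else 0 := by
  rw [adjMatrix_mul_self_apply, secondNeighbor, codegreeExcess]
  by_cases h : x = y
  · subst h; simp [codegree_self]
  · rcases Nat.eq_zero_or_pos (codegree H x y) with h0 | h0
    · simp [h, h0]
    · simp [h, h0, Nat.cast_sub (Nat.succ_le_of_lt h0)]

lemma sum_degree_sq_eq (H : SimpleGraph V) :
    ∑ w, H.degree w ^ 2 = ∑ x, ∑ y, codegree H x y := by
  have h1 : ∀ w, H.degree w ^ 2 = ∑ x, ∑ y, if H.Adj x w ∧ H.Adj w y then 1 else 0 := by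
    intro w
    have e1 : H.degree w = ∑ x, if H.Adj x w then 1 else 0 := by
      rw [← card_filter, ← SimpleGraph.card_neighborFinset_eq_degree]
      congr 1; ext x; simp [H.adj_comm]
    have e2 : H.degree w = ∑ y, if H.Adj w y then 1 else 0 := by
      rw [← card_filter, ← SimpleGraph.card_neighborFinset_eq_degree]
      congr 1; ext x; simp
    rw [sq]
    nth_rewrite 1 [e1]
    rw [e2, sum_mul_sum]
    refine sum_congr rfl fun x _ => sum_congr rfl fun y _ => ?_
    by_cases h1 : H.Adj x w <;> by_cases h2 : H.Adj w y <;> simp [h1, h2]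
  simp only [h1, codegree, card_filter]
  rw [sum_comm]
  exact sum_congr rfl fun x _ => sum_comm

/-- The codegrees sum to at most `2 n² + ∑ deg`, and `2 deg ≤ 1 + deg²` absorbs the linear term into
half of the left side. -/
lemma sum_degree_sq_le (H : SimpleGraph V)
    (h : ∑ x, ∑ y, codegreeExcess H x y ≤ Fintype.card V ^ 2) :
    ∑ w, H.degree w ^ 2 ≤ 5 * Fintype.card V ^ 2 := by
  have h1 : ∑ x, ∑ y, codegree H x y ≤ Fintype.card V ^ 2
      + ∑ x, ∑ y, codegreeExcess H x y + ∑ x, H.degree x := by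
    calc _ ≤ ∑ x, ∑ y, (1 + codegreeExcess H x y + if x = y then H.degree x else 0) :=
          sum_le_sum fun x _ => sum_le_sum fun y _ => codegree_le H x y
      _ = _ := by simp [sum_add_distrib, sq]
  have h2 : 2 * ∑ x, H.degree x ≤ Fintype.card V + ∑ w, H.degree w ^ 2 := by
    calc 2 * ∑ x, H.degree x = ∑ x, 2 * H.degree x := mul_sum _ _ _
      _ ≤ ∑ x, (1 + H.degree x ^ 2) := by
        refine sum_le_sum fun x _ => ?_
        zify
        nlinarith [sq_nonneg ((H.degree x : ℤ) - 1)]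
      _ = _ := by simp [sum_add_distrib]
  have h3 : Fintype.card V ≤ Fintype.card V ^ 2 := Nat.le_self_pow (by norm_num) _
  rw [← sum_degree_sq_eq] at h1
  omega

namespace IsTriangleSystem
variable {G : SimpleGraph V} {T : Finset (V × V × V)}

/-- The union of a triangle system has few pairs with many common neighbours if the ambient graph
has few 5-cycles. -/
lemma sum_codegreeExcess_le (hT : IsTriangleSystem G T) :
    ∑ x, ∑ y, codegreeExcess hT.graph x y
      ≤ 625 * G.copyCount (SimpleGraph.cycleGraph 5) := by
  let N : V × V → Finset V := fun p => {w | hT.graph.Adj p.1 w ∧ hT.graph.Adj w p.2}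
  let Q : Finset (Σ _ : V × V, V × V) :=
    univ.sigma fun p => if p.1 = p.2 then ∅ else (N p).offDiag
  have h1 : ∑ x, ∑ y, codegreeExcess hT.graph x y ≤ #Q := by
    rw [card_sigma, ← Fintype.sum_prod_type' (f := fun x y => codegreeExcess hT.graph x y)]
    refine sum_le_sum fun p _ => ?_
    unfold codegreeExcess
    split_ifs
    · simp
    · rw [offDiag_card]
      change #(N p) - 1 ≤ _
      -- The excess `#(N p) - 1` is at most the number of ordered pairs of distinct common
      -- neighbours, each of which completes a 4-cycle.
      rcases Nat.eq_zero_or_pos #(N p) with h0 | h0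
      · omega
      · calc #(N p) - 1 ≤ #(N p) * (#(N p) - 1) := Nat.le_mul_of_pos_left _ h0
          _ = _ := by rw [Nat.mul_sub, mul_one]
  refine h1.trans (card_le_pow_mul_copyCount (j := 4) G Q
    (fun q => ![q.1.1, q.1.2, q.2.1, q.2.2]) ?_ ?_)
  · rintro ⟨⟨x, y⟩, a, b⟩ ⟨⟨x', y'⟩, a', b'⟩ h
    have e0 := congrFun h 0
    have e1 := congrFun h 1
    have e2 := congrFun h 2
    have e3 := congrFun h 3
    simp at e0 e1 e2 e3
    subst e0 e1 e2 e3
    rfl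
  · rintro ⟨⟨x, y⟩, a, b⟩ hq
    simp only [Q, mem_sigma, mem_univ, true_and] at hq
    split_ifs at hq with hxy
    · simp at hq
    · simp only [N, mem_offDiag, mem_filter, mem_univ, true_and] at hq
      obtain ⟨⟨hxa, hay⟩, ⟨hxb, hby⟩, hab⟩ := hq
      obtain ⟨v, hv, h1, h2, h3, h4⟩ := hT.exists_isPentagon hxa hay hby.symm hxb.symm hxy hab
      refine ⟨v, hv, fun l => ?_⟩
      fin_cases l
      exacts [h1, h2, h3, h4]

/-- A lost triple has an entry in `W` at one of three positions, and by edge-disjointness it is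
determined by that entry and one neighbour. -/
lemma card_le_card_filter_notMem_add (hT : IsTriangleSystem G T) (W : Finset V) :
    #T ≤ #{p ∈ T | p.1 ∉ W ∧ p.2.1 ∉ W ∧ p.2.2 ∉ W} + 3 * ∑ v ∈ W, hT.graph.degree v := by
  have bound : ∀ f g : V × V × V → V, (∀ p ∈ T, hT.graph.Adj (f p) (g p)) →
      (∀ p ∈ T, ∀ q ∈ T, f p = f q → g p = g q → p = q) →
      #{p ∈ T | f p ∈ W} ≤ ∑ v ∈ W, hT.graph.degree v := by
    intro f g hfg hinj
    simp only [← SimpleGraph.card_neighborFinset_eq_degree]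
    rw [← card_sigma]
    refine card_le_card_of_injOn (fun p => ⟨f p, g p⟩) ?_ ?_
    · intro p hp
      rw [mem_coe, mem_filter] at hp
      simp [hp.2, hfg p hp.1]
    · intro p hp q hq hpq
      rw [mem_coe, mem_filter] at hp hq
      simp only [Sigma.mk.injEq, heq_eq_eq] at hpq
      exact hinj p hp.1 q hq.1 hpq.1 hpq.2
  have b1 := bound (fun p => p.1) (fun p => p.2.1) (fun p hp => ⟨_, hp⟩) (by
    rintro ⟨x, y, z⟩ hp ⟨x', y', z'⟩ hq h1 h2
    dsimp only at h1 h2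
    subst h1 h2
    rw [hT.uniq hp hq])
  have b2 := bound (fun p => p.2.1) (fun p => p.1) (fun p hp => ⟨_, hT.swap hp⟩) (by
    rintro ⟨x, y, z⟩ hp ⟨x', y', z'⟩ hq h1 h2
    dsimp only at h1 h2
    subst h1 h2
    rw [hT.uniq hp hq])
  have b3 := bound (fun p => p.2.2) (fun p => p.1) (fun p hp => ⟨_, hT.rot (hT.rot hp)⟩) (by
    rintro ⟨x, y, z⟩ hp ⟨x', y', z'⟩ hq h1 h2
    dsimp only at h1 h2
    subst h1 h2
    rw [hT.uniq (hT.swap_right hp) (hT.swap_right hq)])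
  have hsub : T ⊆ {p ∈ T | p.1 ∉ W ∧ p.2.1 ∉ W ∧ p.2.2 ∉ W} ∪
      ({p ∈ T | p.1 ∈ W} ∪ ({p ∈ T | p.2.1 ∈ W} ∪ {p ∈ T | p.2.2 ∈ W})) := by
    intro p hp
    simp only [mem_union, mem_filter, hp, true_and]
    tauto
  have c1 := (card_le_card hsub).trans (card_union_le _ _)
  have c2 := card_union_le ({p ∈ T | p.1 ∈ W}) ({p ∈ T | p.2.1 ∈ W} ∪ {p ∈ T | p.2.2 ∈ W})
  have c3 := card_union_le ({p ∈ T | p.2.1 ∈ W}) ({p ∈ T | p.2.2 ∈ W})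
  omega

lemma card_third_le (hT : IsTriangleSystem G T) (x y : V) :
    (#{z | (x, y, z) ∈ T} : ℝ) ≤ hT.graph.adjMatrix ℝ x y := by
  rw [SimpleGraph.adjMatrix_apply]
  split_ifs with h
  · have : #{z | (x, y, z) ∈ T} ≤ 1 := card_le_one.2 fun z hz z' hz' => by
      simp only [mem_filter, mem_univ, true_and] at hz hz'
      exact hT.uniq hz hz'
    exact_mod_cast this
  · have : ({z | (x, y, z) ∈ T} : Finset V) = ∅ := by
      ext z
      simp only [mem_filter, mem_univ, true_and, notMem_empty, iff_false]
      exact fun hz => h ⟨z, hz⟩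
    simp [this]

end IsTriangleSystem

/-- Edges inside second neighbourhoods lie on 5-cycles, up to degenerate configurations. -/
lemma card_wedge_le {G H : SimpleGraph V} (hHG : H ≤ G) :
    #{p : V × V × V | (p.1 ≠ p.2.1 ∧ 0 < codegree H p.1 p.2.1) ∧ H.Adj p.2.1 p.2.2 ∧
        (p.1 ≠ p.2.2 ∧ 0 < codegree H p.1 p.2.2)}
      ≤ 125 * G.copyCount (SimpleGraph.cycleGraph 5) + 2 * ∑ w, H.degree w ^ 2
        + ∑ w, H.degree w * ∑ y ∈ H.neighborFinset w, codegree H w y := by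
  let Q : Finset (V × V × V) :=
    {p | ∃ v, IsPentagon G v ∧ p.1 ∈ Set.range v ∧ p.2.1 ∈ Set.range v ∧ p.2.2 ∈ Set.range v}
  -- For paths `x w y` and `x v z`, the closed walk `x w y z v` degenerates when `w = z` (`F1`),
  -- when `v = y` (`F2`), or when `w = v` (`F3`).
  let F1 : Finset (V × V × V) := (univ.sigma fun w => H.neighborFinset w ×ˢ
    H.neighborFinset w).image fun q => (q.2.1, q.2.2, q.1)
  let F2 : Finset (V × V × V) := (univ.sigma fun w => H.neighborFinset w ×ˢ
    H.neighborFinset w).image fun q => (q.2.1, q.1, q.2.2)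
  let F3 : Finset (V × V × V) := (univ.sigma fun w => H.neighborFinset w ×ˢ
    ((H.neighborFinset w).sigma fun y => ({z | H.Adj w z ∧ H.Adj z y} : Finset V))).image
      fun q => (q.2.1, q.2.2.1, q.2.2.2)
  have hQ : #Q ≤ 125 * G.copyCount (SimpleGraph.cycleGraph 5) := by
    refine card_le_pow_mul_copyCount (j := 3) G Q (fun q => ![q.1, q.2.1, q.2.2]) ?_ ?_
    · rintro ⟨x, y, z⟩ ⟨x', y', z'⟩ h
      have e0 := congrFun h 0
      have e1 := congrFun h 1
      have e2 := congrFun h 2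
      simp at e0 e1 e2
      subst e0 e1 e2
      rfl
    · rintro ⟨x, y, z⟩ hq
      simp only [Q, mem_filter, mem_univ, true_and] at hq
      obtain ⟨v, hv, h1, h2, h3⟩ := hq
      refine ⟨v, hv, fun l => ?_⟩
      fin_cases l
      exacts [h1, h2, h3]
  have hF1 : #F1 ≤ ∑ w, H.degree w ^ 2 := by
    refine card_image_le.trans (le_of_eq ?_)
    simp [card_sigma, card_product, sq]
  have hF2 : #F2 ≤ ∑ w, H.degree w ^ 2 := by
    refine card_image_le.trans (le_of_eq ?_)
    simp [card_sigma, card_product, sq]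
  have hF3 : #F3 ≤ ∑ w, H.degree w * ∑ y ∈ H.neighborFinset w, codegree H w y := by
    refine card_image_le.trans (le_of_eq ?_)
    simp [card_sigma, card_product, codegree]
  have hsub : ({p : V × V × V | (p.1 ≠ p.2.1 ∧ 0 < codegree H p.1 p.2.1) ∧ H.Adj p.2.1 p.2.2 ∧
        (p.1 ≠ p.2.2 ∧ 0 < codegree H p.1 p.2.2)} : Finset (V × V × V))
      ⊆ (Q ∪ F1) ∪ (F2 ∪ F3) := by
    rintro ⟨x, y, z⟩ hp
    simp only [mem_filter, mem_univ, true_and] at hp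
    obtain ⟨⟨hxy, hcy⟩, hyz, hxz, hcz⟩ := hp
    obtain ⟨w, hw⟩ := card_pos.1 hcy
    obtain ⟨v, hv⟩ := card_pos.1 hcz
    simp only [mem_filter, mem_univ, true_and] at hw hv
    simp only [mem_union]
    by_cases hwz : w = z
    · subst hwz
      refine Or.inl (Or.inr (mem_image.2 ⟨⟨w, x, y⟩, ?_, rfl⟩))
      simp [hw.1.symm, hw.2]
    by_cases hvy : v = y
    · subst hvy
      refine Or.inr (Or.inl (mem_image.2 ⟨⟨v, x, z⟩, ?_, rfl⟩))
      simp [hv.1.symm, hv.2]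
    by_cases hwv : w = v
    · subst hwv
      refine Or.inr (Or.inr (mem_image.2 ⟨⟨w, x, ⟨y, z⟩⟩, ?_, rfl⟩))
      simp [hw.1.symm, hw.2, hv.2, hyz.symm]
    · refine Or.inl (Or.inl ?_)
      simp only [Q, mem_filter, mem_univ, true_and]
      exact ⟨![x, w, y, z, v], isPentagon_of_adj (hHG hw.1) (hHG hw.2) (hHG hyz)
        (hHG hv.2.symm) (hHG hv.1.symm) hxy hxz hwz hwv (Ne.symm hvy),
        ⟨0, rfl⟩, ⟨2, rfl⟩, ⟨3, rfl⟩⟩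
  have c1 := (card_le_card hsub).trans (card_union_le _ _)
  have c2 := card_union_le Q F1
  have c3 := card_union_le F2 F3
  omega

end Codegrees

/-! ### Pruning and the removal theorem -/

section Removal
open Classical

lemma sum_wedges_eq_card {V : Type*} [Fintype V] (H : SimpleGraph V) :
    ∑ x, ∑ y, ∑ z, secondNeighbor H x y * H.adjMatrix ℝ y z * secondNeighbor H x z
      = #{p : V × V × V | (p.1 ≠ p.2.1 ∧ 0 < codegree H p.1 p.2.1) ∧ H.Adj p.2.1 p.2.2 ∧
        (p.1 ≠ p.2.2 ∧ 0 < codegree H p.1 p.2.2)} := by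
  rw [card_filter, Nat.cast_sum, Fintype.sum_prod_type]
  simp only [Fintype.sum_prod_type, SimpleGraph.adjMatrix_apply, secondNeighbor]
  refine sum_congr rfl fun x _ => sum_congr rfl fun y _ => sum_congr rfl fun z _ => ?_
  split_ifs <;> simp_all

/-- Removing the vertices of large degree or large total codegree excess. -/
lemma IsTriangleSystem.exists_pruned {V : Type*} [Fintype V] {G : SimpleGraph V}
    {T : Finset (V × V × V)} (hT : IsTriangleSystem G T) {r K γ δ : ℝ} (hr : 0 < r)
    (hrn : r ^ 2 = Fintype.card V) (hK : 0 < K) (hγ : 0 < γ) (hδ : 625 * δ ≤ 1)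
    (hC : (G.copyCount (SimpleGraph.cycleGraph 5) : ℝ) ≤ δ * r ^ 4) :
    ∃ T', ∃ hT' : IsTriangleSystem G T',
      (#T : ℝ) ≤ #T' + (15 / K + 1875 * δ * K / γ) * r ^ 3 ∧
      (∀ x, (hT'.graph.degree x : ℝ) ≤ K * r) ∧
      ∀ x, (∑ y, codegreeExcess hT'.graph x y : ℝ) ≤ γ * r ^ 2 := by
  set H := hT.graph with hH
  have hE : (∑ x, ∑ y, codegreeExcess H x y : ℝ) ≤ 625 * δ * r ^ 4 := by
    have h1 : (∑ x, ∑ y, codegreeExcess H x y : ℝ)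
        ≤ 625 * G.copyCount (SimpleGraph.cycleGraph 5) := by
      exact_mod_cast hT.sum_codegreeExcess_le
    linarith
  have hdeg : (∑ w, (H.degree w : ℝ) ^ 2) ≤ 5 * r ^ 4 := by
    have h1 : ∑ x, ∑ y, codegreeExcess H x y ≤ Fintype.card V ^ 2 := by
      have : (∑ x, ∑ y, codegreeExcess H x y : ℝ) ≤ (Fintype.card V : ℝ) ^ 2 := by
        rw [← hrn]
        calc _ ≤ 625 * δ * r ^ 4 := hE
          _ ≤ 1 * r ^ 4 := mul_le_mul_of_nonneg_right hδ (by positivity)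
          _ = _ := by ring
      exact_mod_cast this
    have h2 : (∑ w, (H.degree w : ℝ) ^ 2) ≤ 5 * (Fintype.card V : ℝ) ^ 2 := by
      exact_mod_cast sum_degree_sq_le H h1
    rw [← hrn] at h2
    linarith
  let W : Finset V := {x | K * r < H.degree x ∨ γ * r ^ 2 < ∑ y, (codegreeExcess H x y : ℝ)}
  have hW : (∑ v ∈ W, H.degree v : ℝ) ≤ (5 / K + 625 * δ * K / γ) * r ^ 3 := by
    -- A vertex of degree `d > K r` satisfies `d ≤ d² / (K r)`. Any other vertex of `W` has degree
    -- at most `K r` and excess above `γ r²`, so its degree is at most `K / (γ r)` times its excess.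
    calc (∑ v ∈ W, H.degree v : ℝ)
        ≤ ∑ v ∈ W, ((H.degree v : ℝ) ^ 2 / (K * r)
            + (∑ y, (codegreeExcess H v y : ℝ)) * (K / (γ * r))) := by
          refine sum_le_sum fun v hv => ?_
          have hd0 : (0 : ℝ) ≤ H.degree v := Nat.cast_nonneg _
          have he0 : (0 : ℝ) ≤ ∑ y, (codegreeExcess H v y : ℝ) :=
            sum_nonneg fun y _ => Nat.cast_nonneg _
          by_cases h : K * r < H.degree v
          · have h1 : (H.degree v : ℝ) ≤ (H.degree v : ℝ) ^ 2 / (K * r) := by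
              rw [le_div_iff₀ (by positivity), sq]
              exact mul_le_mul_of_nonneg_left h.le hd0
            have : 0 ≤ (∑ y, (codegreeExcess H v y : ℝ)) * (K / (γ * r)) := by positivity
            linarith
          · have h2 : γ * r ^ 2 < ∑ y, (codegreeExcess H v y : ℝ) := by
              simp only [W, mem_filter, mem_univ, true_and] at hv
              exact hv.resolve_left h
            have h3 : γ * r ^ 2 * (K / (γ * r))
                ≤ (∑ y, (codegreeExcess H v y : ℝ)) * (K / (γ * r)) :=
              mul_le_mul_of_nonneg_right h2.le (by positivity)
            have h4 : γ * r ^ 2 * (K / (γ * r)) = K * r := by field_simp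
            have : 0 ≤ (H.degree v : ℝ) ^ 2 / (K * r) := by positivity
            linarith
      _ ≤ ∑ v, ((H.degree v : ℝ) ^ 2 / (K * r)
            + (∑ y, (codegreeExcess H v y : ℝ)) * (K / (γ * r))) :=
          sum_le_sum_of_subset_of_nonneg (subset_univ _) fun v _ _ => by positivity
      _ = (∑ v, (H.degree v : ℝ) ^ 2) / (K * r)
            + (∑ v, ∑ y, (codegreeExcess H v y : ℝ)) * (K / (γ * r)) := by
          rw [sum_add_distrib, sum_div, sum_mul]
      _ ≤ 5 * r ^ 4 / (K * r) + 625 * δ * r ^ 4 * (K / (γ * r)) := by gcongr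
      _ = _ := by field_simp
  have hT' := hT.filter_notMem W
  have hle : hT'.graph ≤ H := hT.graph_mono hT' (filter_subset _ _)
  have hiso : ∀ x ∈ W, ∀ y, ¬ hT'.graph.Adj x y := by
    rintro x hx y ⟨z, hz⟩
    exact (mem_filter.1 hz).2.1 hx
  refine ⟨_, hT', ?_, fun x => ?_, fun x => ?_⟩
  · have h1 := hT.card_le_card_filter_notMem_add W
    have h2 : (#T : ℝ) ≤ #{p ∈ T | p.1 ∉ W ∧ p.2.1 ∉ W ∧ p.2.2 ∉ W}
        + 3 * ∑ v ∈ W, (H.degree v : ℝ) := by exact_mod_cast h1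
    have h3 : 3 * ((5 / K + 625 * δ * K / γ) * r ^ 3)
        = (15 / K + 1875 * δ * K / γ) * r ^ 3 := by ring
    linarith
  · by_cases hx : x ∈ W
    · have : hT'.graph.degree x = 0 := by
        rw [← SimpleGraph.card_neighborFinset_eq_degree, card_eq_zero]
        ext y; simpa using hiso x hx y
      rw [this]; simp; positivity
    · have h1 : hT'.graph.degree x ≤ H.degree x := SimpleGraph.degree_le_of_le hle
      have h2 : (H.degree x : ℝ) ≤ K * r := by
        by_contra h
        exact hx (by simp only [W, mem_filter, mem_univ, true_and]; exact Or.inl (not_le.1 h))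
      exact le_trans (by exact_mod_cast h1) h2
  · by_cases hx : x ∈ W
    · have : ∀ y, codegreeExcess hT'.graph x y = 0 := by
        intro y
        have : codegree hT'.graph x y = 0 := by
          rw [codegree, card_eq_zero]
          ext w; simp [hiso x hx w]
        simp [codegreeExcess, this]
      simp only [this]; simp; positivity
    · refine le_trans (sum_le_sum fun y _ => Nat.cast_le.2 (codegreeExcess_mono hle x y)) ?_
      by_contra h
      exact hx (by simp only [W, mem_filter, mem_univ, true_and]; exact Or.inr (not_le.1 h))

/-- A large edge-disjoint family of triangles forces many 5-cycles. -/
theorem exists_mul_sq_lt_copyCount {ε : ℝ} (hε : 0 < ε) :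
    ∃ (n₀ : ℕ) (δ : ℝ), 0 < δ ∧ ∀ (V : Type u) [Fintype V], n₀ ≤ Fintype.card V →
      ∀ (G : SimpleGraph V) (T : Finset (V × V × V)), IsTriangleSystem G T →
      ε * √(Fintype.card V : ℝ) ^ 3 ≤ #T →
      δ * (Fintype.card V : ℝ) ^ 2 < G.copyCount (SimpleGraph.cycleGraph 5) := by
  obtain ⟨K, hK⟩ : ∃ K, K = 60 / ε := ⟨_, rfl⟩
  have hK0 : 0 < K := by rw [hK]; positivity
  obtain ⟨κ, hκ, ω, hω, n₁, hcore⟩ :=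
    exists_many_second_neighborhood_edges.{u} (ε := ε / 2) (K := K) (by positivity) hK0
  -- The bound `ω / 2` leaves room for the diagonal of the squared adjacency matrix; `κ / (8 K)`
  -- bounds the degenerate triples. Below, `1 / 625` in `δ` gives the degree-square bound, and its
  -- other term, with `15 / K = ε / 4`, keeps the pruning loss within `ε / 2 * r³`.
  obtain ⟨γ, hγ⟩ : ∃ γ, γ = min (ω / 2) (κ / (8 * K)) := ⟨_, rfl⟩
  have hγ0 : 0 < γ := by rw [hγ]; exact lt_min (by positivity) (by positivity)
  have hγ1 : γ ≤ ω / 2 := by rw [hγ]; exact min_le_left _ _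
  have hγ2 : K * γ ≤ κ / 8 := by
    have : γ ≤ κ / (8 * K) := by rw [hγ]; exact min_le_right _ _
    rw [le_div_iff₀ (by positivity)] at this
    linarith
  obtain ⟨δ, hδ⟩ : ∃ δ, δ = min (1 / 625) (ε * γ / (7500 * K)) := ⟨_, rfl⟩
  have hδ0 : 0 < δ := by rw [hδ]; exact lt_min (by positivity) (by positivity)
  have hδ1 : 625 * δ ≤ 1 := by
    have : δ ≤ 1 / 625 := by rw [hδ]; exact min_le_left _ _
    linarith
  have hδ2 : 1875 * δ * K / γ ≤ ε / 4 := by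
    have : δ ≤ ε * γ / (7500 * K) := by rw [hδ]; exact min_le_right _ _
    rw [le_div_iff₀ (by positivity)] at this
    rw [div_le_iff₀ hγ0]
    linarith
  obtain ⟨R, hR⟩ : ∃ R : ℝ, R = max (2 * K / ω) (2 * (125 + 3 * K ^ 2) / κ) := ⟨_, rfl⟩
  obtain ⟨n₂, hn₂⟩ := exists_nat_ge (R ^ 2)
  refine ⟨max (max n₁ n₂) 1, δ, hδ0, ?_⟩
  intro V _ hV G T hT hcard
  have hV1 : n₁ ≤ Fintype.card V := (le_max_left _ _).trans ((le_max_left _ _).trans hV)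
  have hV2 : n₂ ≤ Fintype.card V := (le_max_right _ _).trans ((le_max_left _ _).trans hV)
  have hV3 : 0 < Fintype.card V := (le_max_right _ _).trans hV
  obtain ⟨r, hr⟩ : ∃ r, r = √(Fintype.card V : ℝ) := ⟨_, rfl⟩
  have hr0 : 0 < r := by rw [hr]; exact Real.sqrt_pos.2 (by exact_mod_cast hV3)
  have hrn : r ^ 2 = Fintype.card V := by rw [hr]; exact Real.sq_sqrt (Nat.cast_nonneg _)
  rw [← hr] at hcard
  have hrR : R ≤ r := by
    refine le_of_sq_le_sq ?_ hr0.le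
    rw [hrn]
    exact hn₂.trans (by exact_mod_cast hV2)
  have hr1 : K * r ≤ ω / 2 * r ^ 2 := by
    have : 2 * K / ω ≤ r := by rw [hR] at hrR; exact (le_max_left _ _).trans hrR
    rw [div_le_iff₀ hω] at this
    nlinarith
  have hr2 : 2 * (125 + 3 * K ^ 2) ≤ κ * r := by
    have : 2 * (125 + 3 * K ^ 2) / κ ≤ r := by rw [hR] at hrR; exact (le_max_right _ _).trans hrR
    rw [div_le_iff₀ hκ] at this
    linarith
  by_contra! hC
  have hC' : (G.copyCount (SimpleGraph.cycleGraph 5) : ℝ) ≤ δ * r ^ 4 := by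
    rw [← hrn] at hC
    linarith
  obtain ⟨T', hT', hTT', hdeg, hexc⟩ := hT.exists_pruned hr0 hrn hK0 hγ0 hδ1 hC'
  set H := hT'.graph with hH
  have hT'card : ε / 2 * r ^ 3 ≤ #T' := by
    have h1 : 15 / K = ε / 4 := by rw [hK]; field_simp; norm_num
    have h2 : (15 / K + 1875 * δ * K / γ) * r ^ 3 ≤ ε / 2 * r ^ 3 :=
      mul_le_mul_of_nonneg_right (by linarith) (by positivity)
    linarith
  have hwedge := hcore V hV1 r hr0 hrn (H.adjMatrix ℝ) (secondNeighbor H)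
    (H.transpose_adjMatrix)
    (fun x y => by rw [SimpleGraph.adjMatrix_apply]; split_ifs <;> norm_num)
    (fun x => by
      have : ∑ y, H.adjMatrix ℝ x y = H.degree x := by
        simp [SimpleGraph.adjMatrix_apply, ← SimpleGraph.card_neighborFinset_eq_degree,
          SimpleGraph.neighborFinset_eq_filter]
      rw [this]; exact hdeg x)
    (fun x y => by unfold secondNeighbor; split_ifs <;> norm_num)
    (fun x y => by unfold secondNeighbor; split_ifs <;> norm_num)
    (fun x y => by
      rw [← sub_nonneg, adjMatrix_sq_sub_secondNeighbor]
      split_ifs <;> positivity)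
    (fun x => by
      simp only [adjMatrix_sq_sub_secondNeighbor, sum_add_distrib]
      have h1 := hexc x
      have h2 := hdeg x
      have h3 : γ * r ^ 2 ≤ ω / 2 * r ^ 2 := mul_le_mul_of_nonneg_right hγ1 (by positivity)
      simp only [sum_ite_eq, mem_univ, if_true]
      linarith)
    T' (fun x y => by convert hT'.card_third_le x y)
    (fun x z => by
      convert hT'.card_third_le x z using 3
      ext w
      simp only [mem_filter, mem_univ, true_and]
      exact ⟨hT'.swap_right, hT'.swap_right⟩)
    (fun y z => by
      convert hT'.card_third_le y z using 3
      ext w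
      simp only [mem_filter, mem_univ, true_and]
      exact ⟨hT'.rot, fun h => hT'.rot (hT'.rot h)⟩) hT'card
  rw [sum_wedges_eq_card] at hwedge
  have hw : (#{p : V × V × V | (p.1 ≠ p.2.1 ∧ 0 < codegree H p.1 p.2.1) ∧ H.Adj p.2.1 p.2.2 ∧
        (p.1 ≠ p.2.2 ∧ 0 < codegree H p.1 p.2.2)} : ℝ)
      ≤ 125 * G.copyCount (SimpleGraph.cycleGraph 5) + 2 * ∑ w, (H.degree w : ℝ) ^ 2
        + ∑ w, (H.degree w : ℝ) * ∑ y ∈ H.neighborFinset w, (codegree H w y : ℝ) := by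
    exact_mod_cast card_wedge_le hT'.graph_le
  have hsq : ∑ w, (H.degree w : ℝ) ^ 2 ≤ K ^ 2 * r ^ 4 := by
    calc _ ≤ ∑ _w : V, (K * r) ^ 2 :=
          sum_le_sum fun w _ => pow_le_pow_left₀ (Nat.cast_nonneg _) (hdeg w) 2
      _ = _ := by rw [sum_const, card_univ, nsmul_eq_mul, ← hrn]; ring
  have hthird : ∑ w, (H.degree w : ℝ) * ∑ y ∈ H.neighborFinset w, (codegree H w y : ℝ)
      ≤ K ^ 2 * r ^ 4 + K * γ * r ^ 5 := by
    calc _ ≤ ∑ _w : V, (K * r) * (K * r + γ * r ^ 2) := by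
          refine sum_le_sum fun w _ => mul_le_mul (hdeg w) ?_
            (sum_nonneg fun y _ => Nat.cast_nonneg _) (by positivity)
          calc ∑ y ∈ H.neighborFinset w, (codegree H w y : ℝ)
              ≤ ∑ y ∈ H.neighborFinset w, (1 + (codegreeExcess H w y : ℝ)) := by
                refine sum_le_sum fun y hy => ?_
                have h1 := codegree_le H w y
                rw [SimpleGraph.mem_neighborFinset] at hy
                rw [if_neg hy.ne] at h1
                exact_mod_cast h1
            _ = H.degree w + ∑ y ∈ H.neighborFinset w, (codegreeExcess H w y : ℝ) := by
                rw [sum_add_distrib]; simp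
            _ ≤ H.degree w + ∑ y, (codegreeExcess H w y : ℝ) := by
                gcongr; exact subset_univ _
            _ ≤ _ := add_le_add (hdeg w) (hexc w)
      _ = _ := by rw [sum_const, card_univ, nsmul_eq_mul, ← hrn]; ring
  -- Otherwise `κ r⁵ ≤ (125 + 3 K²) r⁴ + K γ r⁵`, whose right side is at most `(κ / 2 + κ / 8) r⁵`.
  have f1 : K * γ * r ^ 5 ≤ κ / 8 * r ^ 5 := mul_le_mul_of_nonneg_right hγ2 (by positivity)
  have f2 : 2 * (125 + 3 * K ^ 2) * r ^ 4 ≤ κ * r * r ^ 4 :=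
    mul_le_mul_of_nonneg_right hr2 (by positivity)
  have f3 : δ * r ^ 4 ≤ 1 * r ^ 4 := mul_le_mul_of_nonneg_right (by linarith) (by positivity)
  have f4 : 0 < κ * r ^ 5 := by positivity
  have f5 : κ * r * r ^ 4 = κ * r ^ 5 := by ring
  linarith

theorem exists_deleteEdges_cliqueFree_three {ε : ℝ} (hε : 0 < ε) :
    ∃ (n₀ : ℕ) (δ : ℝ), 0 < δ ∧
      ∀ n : ℕ, n₀ ≤ n → ∀ (V : Type u) [Fintype V] (G : SimpleGraph V),
        Fintype.card V = n →
        (G.copyCount (SimpleGraph.cycleGraph 5) : ℝ) ≤ δ * (n : ℝ) ^ 2 →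
        ∃ S : Finset (Sym2 V), (S : Set (Sym2 V)) ⊆ G.edgeSet ∧
          (S.card : ℝ) ≤ ε * (n : ℝ) ^ (3 / 2 : ℝ) ∧
          (G.deleteEdges (S : Set (Sym2 V))).CliqueFree 3 := by
  obtain ⟨n₀, δ, hδ, h⟩ := exists_mul_sq_lt_copyCount.{u} hε
  refine ⟨n₀, δ, hδ, ?_⟩
  rintro n hn V _ G rfl hC
  obtain ⟨T, hT, S, hS, hST, hfree⟩ := exists_isTriangleSystem G
  refine ⟨S, hS, ?_, hfree⟩
  by_contra! hlt
  have hpow : (Fintype.card V : ℝ) ^ (3 / 2 : ℝ) = √(Fintype.card V : ℝ) ^ 3 := by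
    rw [Real.sqrt_eq_rpow, ← Real.rpow_natCast, ← Real.rpow_mul (Nat.cast_nonneg _)]
    norm_num
  rw [hpow] at hlt
  have := h V hn G T hT (hlt.le.trans (by exact_mod_cast hST))
  linarith

end Removal

end

theorem mainTheorem4 :
    (∀ ε : ℝ, 0 < ε → ∃ (n₀ : ℕ) (δ : ℝ), 0 < δ ∧
      ∀ n : ℕ, n₀ ≤ n → ∀ (V : Type u) [Fintype V] (G : SimpleGraph V),
        Fintype.card V = n →
        (G.copyCount (SimpleGraph.cycleGraph 5) : ℝ) ≤ δ * (n : ℝ) ^ 2 →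
        ∃ S : Finset (Sym2 V), (S : Set (Sym2 V)) ⊆ G.edgeSet ∧
          (S.card : ℝ) ≤ ε * (n : ℝ) ^ (3 / 2 : ℝ) ∧
          (G.deleteEdges (S : Set (Sym2 V))).CliqueFree 3) ∧
    (∀ ε : ℝ, 0 < ε → ∃ n₀ : ℕ,
      ∀ n : ℕ, n₀ ≤ n → ∀ (V : Type u) [Fintype V] (G : SimpleGraph V),
        Fintype.card V = n →
        (SimpleGraph.cycleGraph 5).Free G →
        ∃ S : Finset (Sym2 V), (S : Set (Sym2 V)) ⊆ G.edgeSet ∧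
          (S.card : ℝ) ≤ ε * (n : ℝ) ^ (3 / 2 : ℝ) ∧
          (G.deleteEdges (S : Set (Sym2 V))).CliqueFree 3) := by
  refine ⟨fun ε hε => exists_deleteEdges_cliqueFree_three hε, fun ε hε => ?_⟩
  obtain ⟨n₀, δ, hδ, h⟩ := exists_deleteEdges_cliqueFree_three.{u} hε
  refine ⟨n₀, fun n hn V _ G hV hfree => h n hn V G hV ?_⟩
  rw [SimpleGraph.copyCount_eq_zero.2 hfree]
  simp only [Nat.cast_zero]
  positivity
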